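/- **Setting.** Let $Q$ be a finite group with subgroups $F,G$ such that $Q=FG$ and $F\cap G=1$. For $y\in G$, $a\in F$ write $ya=(y\rhd a)(y\lhd a)$ with $y\rhd a\in F$, $y\lhd a\in G$; then $\lhd$ is a right action of $F$ on $G$, and $F_x\le F$ denotes the stabilizer of $x\in G$. For a field $E$ the bismash product $H_E=E^G\# EF$ has, as an algebra, the basis $\{p_y\#a : y\in G,\ a\in F\}$ and multiplication $(p_x\#a)(p_y\#b)=\delta_{y,\,x\lhd a}\,p_x\#ab$. If $V$ is an $EF_x$-module, the induced module $\hat V=EF\otimes_{EF_x}V$ is an $H_E$-module via $(p_y\#a)[b\otimes v]=\delta_{y\lhd(ab),x}\,[ab\otimes v]$. Let $L$ be a number field that splits $H_L$ (every endomorphism of a simple $H_L$-module is a scalar), $p$ a prime, $\mathcal P$ a prime ideal of the ring of integers of $L$ containing $p$, $K$ the completion of $L$ at $\mathcal P$, $R$ its valuation ring, $k$ the residue field of $R$. Let $\bar K,\bar k$ be algebraic closures, $\bar R$ the integral closure of $R$ in $\bar K$, and $f:\bar R\to\bar k$ a ring homomorphism extending $R\to k$. For a finite group $\Gamma$ let $\Gamma_{p'}$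 be the set of its elements of order prime to $p$. The Brauer character of a finite-dimensional $k\Gamma$-module is the function on $\Gamma_{p'}$ whose value at $g$ is the sum, over the eigenvalues $\zeta\in\bar k$ of $g$ with multiplicity, of the unique root of unity of order prime to $p$ in $\bar R$ that $f$ maps to $\zeta$. Let $\mathcal B_{p'}=\{p_y\#a : a\in F_y\cap F_{p'}\}$. If $V$ is a simple $KF_x$-module with character $\chi$, let $\hat\chi$ be the character of the $H_K$-module $\hat V$. If $W$ is a simple $kF_x$-module with Brauer character $\phi$, the Brauer character of the $H_k$-module $\hat W$ is the function on $\mathcal B_{p'}$ $$\hat\phi(p_y\#a)=\sum_{t\in T_x,\ t^{-1}at\in F_x}\delta_{y\lhd t,\,x}\,\phi(t^{-1}at),$$ where $T_x$ is a set of representatives of the cosets $tF_x$ in $F$. A decomposition matrix of functions $(\chi_i)$ with respect to functions $(\phi_j)$ is an integer matrix $(d_{ij})$ with $\chi_i=\sum_j d_{ij}\phi_j$ for all $i$. **Proposition.** Assume that $F$ has exactly $s$ orbits $\mathcal O_1,\dots,\mathcal O_s$ on $G$ and choose $x_q\in\mathcal O_q$. For each $q$ let $V_{i,x_q}$ $(1\le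 i\le n_q)$ and $W_{j,x_q}$ $(1\le j\le d_q)$ be complete irredundant lists of the simple $KF_{x_q}$-modules and of the simple $kF_{x_q}$-modules up to isomorphism, with characters $\chi_{i,x_q}$ and Brauer characters $\phi_{j,x_q}$ respectively. Then the $\hat V_{i,x_q}$, over all $q$ and $i$, form a complete irredundant list of the simple $H_K$-modules, the $\hat W_{j,x_q}$, over all $q$ and $j$, form one of the simple $H_k$-modules, and the following hold. (1) For each $q$ the functions $\chi_{i,x_q}|_{(F_{x_q})_{p'}}$ have exactly one decomposition matrix $D_{x_q}$ with respect to the $\phi_{j,x_q}$, the functions $\hat\chi_{i,x_q}|_{\mathcal B_{p'}}$ have exactly one decomposition matrix $\hat D_{x_q}$ with respect to the $\hat\phi_{j,x_q}$, and $\hat D_{x_q}=D_{x_q}$. (2) The family of all $\hat\chi_{i,x_q}|_{\mathcal B_{p'}}$ has exactly one decomposition matrix $\hat D$ with respect to the family of all $\hat\phi_{j,x_q}$, namely the block diagonal matrix $$\hat D=\operatorname{diag}(\hat D_{x_1},\dots,\hat D_{x_s}).$$ -/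

import Mathlib

universe u w

noncomputable section

open scoped Classical

namespace BismashProduct

/-! ### Factorizable groups and the action of `F` on `G` -/

section Action

variable {Q : Type w} [Group Q] {F G : Subgroup Q}

/-- `y ◁ a ∈ G` for `y ∈ G`, `a ∈ F`: the `G`-component of `y * a` in the factorization `Q = F G`,
that is `y * a = (y ▷ a) * (y ◁ a)` with `y ▷ a ∈ F`. -/
def act (h : F.IsComplement' G) (y : G) (a : F) : G :=
  (h.equiv ((y : Q) * (a : Q))).2

theorem act_one (h : F.IsComplement' G) (y : G) : act h y 1 = y := by
  have := h.equiv_snd_eq_self_of_mem_of_one_mem F.one_mem (g := (y : Q)) y.2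
  simpa [act] using this

theorem act_mul (h : F.IsComplement' G) (y : G) (a b : F) :
    act h y (a * b) = act h (act h y a) b := by
  have h1 : (y : Q) * ((a * b : F) : Q) =
      ((h.equiv ((y : Q) * (a : Q))).1 : Q) * ((act h y a : Q) * (b : Q)) := by
    have := h.equiv_fst_mul_equiv_snd ((y : Q) * (a : Q))
    rw [← mul_assoc, act, this, Subgroup.coe_mul, mul_assoc]
  unfold act at h1 ⊢
  rw [h1]
  have h2 := congrArg Prod.snd (h.equiv_mul_left (h.equiv ((y : Q) * (a : Q))).1
    (((h.equiv ((y : Q) * (a : Q))).2 : Q) * (b : Q)))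
  exact h2

/-- The stabilizer `F_x` of `x ∈ G` in `F`. -/
def stab (h : F.IsComplement' G) (x : G) : Subgroup F where
  carrier := {a | act h x a = x}
  one_mem' := act_one h x
  mul_mem' {a b} ha hb := by
    have ha' : act h x a = x := ha
    have hb' : act h x b = x := hb
    change act h x (a * b) = x
    rw [act_mul, ha', hb']
  inv_mem' {a} ha := by
    have ha' : act h x a = x := ha
    change act h x a⁻¹ = x
    conv_lhs => rw [← ha']
    rw [← act_mul, mul_inv_cancel, act_one]

end Action

/-! ### The bismash product `E^G # E F` -/

section Algebra

variable {Q : Type w} [Group Q] {F G : Subgroup Q}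

/-- The algebra `E^G` of functions on `G`; the complement hypothesis is a parameter because it
determines the action of `F`. -/
def FunAlg (_h : F.IsComplement' G) (E : Type u) : Type (max u w) := G → E

/-- The value at `y` of a function on `G`. -/
def FunAlg.eval {h : F.IsComplement' G} {E : Type u} (g : FunAlg h E) (y : G) : E := g y

instance (h : F.IsComplement' G) (E : Type u) [Field E] : CommRing (FunAlg h E) :=
  inferInstanceAs (CommRing (G → E))

instance (h : F.IsComplement' G) (E : Type u) [Field E] : Algebra E (FunAlg h E) :=
  inferInstanceAs (Algebra E (G → E))

/-- The action of `F` on `E^G`, `(a • g) y = g (y ◁ a)`, so that `a • p_y = p_{y ◁ a⁻¹}`. -/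
instance (h : F.IsComplement' G) (E : Type u) [Field E] : MulSemiringAction F (FunAlg h E) where
  smul a g := fun y => g (act h y a)
  one_smul g := funext fun y => congrArg g (act_one h y)
  mul_smul a b g := funext fun y => congrArg g (act_mul h y a b)
  smul_zero _ := rfl
  smul_add _ _ _ := rfl
  smul_one _ := rfl
  smul_mul _ _ _ := rfl

instance (h : F.IsComplement' G) (E : Type u) [Field E] : SMulCommClass F E (FunAlg h E) :=
  ⟨fun _ _ _ => rfl⟩

/-- The algebra underlying the bismash product `H_E = E^G # E F`: the smash product of `E^G` with
the group algebra `E F`, i.e. the skew group algebra of `F` over `E^G`. -/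
abbrev Bismash (h : F.IsComplement' G) (E : Type u) [Field E] : Type (max u w) :=
  SkewMonoidAlgebra (FunAlg h E) F

/-- The idempotent `p_y ∈ E^G`. -/
def delta (h : F.IsComplement' G) (E : Type u) [Field E] (y : G) : FunAlg h E :=
  fun z => if z = y then 1 else 0

/-- The element `p_y # a` of the distinguished basis. -/
def basisElt (h : F.IsComplement' G) (E : Type u) [Field E] (y : G) (a : F) : Bismash h E :=
  SkewMonoidAlgebra.single a (delta h E y)

/-- `(p_x # a) (p_y # b) = δ_{y, x ◁ a} p_x # a b`. -/
theorem basisElt_mul (h : F.IsComplement' G) (E : Type u) [Field E] (x y : G) (a b : F) :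
    basisElt h E x a * basisElt h E y b =
      if y = act h x a then basisElt h E x (a * b) else 0 := by
  have key : delta h E x * a • delta h E y = if y = act h x a then delta h E x else 0 := by
    funext z
    change (if z = x then (1 : E) else 0) * (if act h z a = y then 1 else 0) = _
    by_cases hz : z = x
    · subst hz
      by_cases hy : y = act h z a
      · simp [hy, delta]
      · rw [if_neg hy, if_neg (Ne.symm hy), mul_zero]
        rfl
    · rw [if_neg hz, zero_mul]
      split_ifs
      · simp [delta, hz]
      · rfl
  rw [basisElt, basisElt, SkewMonoidAlgebra.single_mul_single, key]
  split_ifs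
  · rfl
  · simp

end Algebra

/-! ### Simple modules -/

/-- `V` is a complete irredundant list of irreducible representations of `Γ` over `E`, up to
isomorphism. -/
def IsCompleteIrreps {E : Type u} [Field E] {Γ : Type w} [Group Γ] {ι : Type*} {V : ι → Type u}
    [∀ i, AddCommGroup (V i)] [∀ i, Module E (V i)] (ρ : ∀ i, Representation E Γ (V i)) : Prop :=
  (∀ i, (ρ i).IsIrreducible) ∧
  (∀ i j, Nonempty ((ρ i).Equiv (ρ j)) → i = j) ∧
  ∀ (U : Type u) [AddCommGroup U] [Module E U] (σ : Representation E Γ U),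
    σ.IsIrreducible → ∃ i, Nonempty (σ.Equiv (ρ i))

/-- `M` is a complete irredundant list of simple modules over the ring `A`, up to isomorphism
(universe `r` is that of the test modules). -/
def IsCompleteSimples.{r} (A : Type*) [Ring A] {ι : Type*} (M : ι → Type*)
    [∀ i, AddCommGroup (M i)] [∀ i, Module A (M i)] : Prop :=
  (∀ i, IsSimpleModule A (M i)) ∧
  (∀ i j, Nonempty (M i ≃ₗ[A] M j) → i = j) ∧
  ∀ (U : Type r) [AddCommGroup U] [Module A U],
    IsSimpleModule A U → ∃ i, Nonempty (U ≃ₗ[A] M i)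

/-- The finite-dimensional `E`-algebra `A` is split over `E`: every endomorphism of a simple
`A`-module is a scalar. -/
def IsSplit (E : Type u) [Field E] (A : Type*) [Ring A] [Algebra E A] : Prop :=
  ∀ (U : Type u) [AddCommGroup U] [Module E U] [Module A U] [IsScalarTower E A U],
    IsSimpleModule A U → ∀ f : U →ₗ[A] U, ∃ c : E, ∀ m : U, f m = c • m

/-! ### The induced modules -/

section Induced

variable {Q : Type w} [Group Q] {F G : Subgroup Q} (h : F.IsComplement' G)
  {E : Type u} [Field E] (x : G) {V : Type u} [AddCommGroup V] [Module E V]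
  (ρ : Representation E (stab h x) V)

/-- The induced module `V̂ = E F ⊗_{E F_x} V`. In Mathlib's model, `IndV.mk _ ρ c v` is the class
of `c⁻¹ ⊗ v`. -/
def Induced : Type (max u w) := Representation.IndV (stab h x).subtype ρ

instance : AddCommGroup (Induced h x ρ) :=
  inferInstanceAs (AddCommGroup (Representation.IndV (stab h x).subtype ρ))

instance : Module E (Induced h x ρ) :=
  inferInstanceAs (Module E (Representation.IndV (stab h x).subtype ρ))

/-- The class of `b ⊗ v` in `E F ⊗_{E F_x} V`. -/
def Induced.tmul (b : F) : V →ₗ[E] Induced h x ρ :=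
  Representation.IndV.mk (stab h x).subtype ρ b⁻¹

/-- Multiplication of `E F` by the function `c ↦ g (x ◁ c)` on the basis `F`. -/
def scaleBasis (g : FunAlg h E) : MonoidAlgebra E F →ₗ[E] MonoidAlgebra E F :=
  (MonoidAlgebra.basis F E).constr E fun c => g.eval (act h x c) • MonoidAlgebra.single c (1 : E)

theorem scaleBasis_single (g : FunAlg h E) (c : F) (r : E) :
    scaleBasis h x g (MonoidAlgebra.single c r) =
      g.eval (act h x c) • MonoidAlgebra.single c r := by
  have h1 : (MonoidAlgebra.single c r : MonoidAlgebra E F) = r • (MonoidAlgebra.basis F E) c := by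
    simp
  rw [h1, map_smul, scaleBasis, Module.Basis.constr_basis, MonoidAlgebra.basis_apply, smul_comm]

/-- The action of `g ∈ E^G` on `V̂`: `g [b ⊗ v] = g (x ◁ b⁻¹) [b ⊗ v]`, so that
`p_y [b ⊗ v] = δ_{y ◁ b, x} [b ⊗ v]`. -/
def funAction (g : FunAlg h E) : Module.End E (Induced h x ρ) :=
  Representation.Coinvariants.map _ _
    ⟨(scaleBasis h x g).rTensor V, fun c => by
      ext d v
      have hc : act h x c = x := c.2
      simp [scaleBasis_single, act_mul, hc]⟩

theorem funAction_tmul (g : FunAlg h E) (b : F) (v : V) :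
    funAction h x ρ g (Induced.tmul h x ρ b v) =
      g.eval (act h x b⁻¹) • Induced.tmul h x ρ b v := by
  change Representation.Coinvariants.map _ _ _ (Representation.Coinvariants.mk _ _) = _
  rw [Representation.Coinvariants.map_mk]
  change Representation.Coinvariants.mk _ ((scaleBasis h x g).rTensor V _) = _
  rw [TensorProduct.mk_apply, LinearMap.rTensor_tmul, scaleBasis_single, ← TensorProduct.smul_tmul',
    map_smul]
  rfl

theorem Induced.hom_ext {f g : Module.End E (Induced h x ρ)}
    (hfg : ∀ (b : F) (v : V), f (Induced.tmul h x ρ b v) = g (Induced.tmul h x ρ b v)) :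
    f = g := by
  refine Representation.IndV.hom_ext (stab h x).subtype ρ (B := Induced h x ρ) fun c => ?_
  ext v
  have := hfg c⁻¹ v
  rwa [Induced.tmul, inv_inv] at this

/-- The algebra `E^G` acting on `V̂`. -/
def funActionHom : FunAlg h E →ₐ[E] Module.End E (Induced h x ρ) :=
  AlgHom.ofLinearMap
    { toFun := funAction h x ρ
      map_add' := fun g g' => Induced.hom_ext h x ρ fun b v => by
        rw [LinearMap.add_apply, funAction_tmul, funAction_tmul, funAction_tmul]
        exact add_smul _ _ _
      map_smul' := fun r g => Induced.hom_ext h x ρ fun b v => by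
        rw [RingHom.id_apply, LinearMap.smul_apply, funAction_tmul, funAction_tmul]
        exact mul_smul r (g.eval (act h x b⁻¹)) _ }
    (Induced.hom_ext h x ρ fun b v => by
      change funAction h x ρ 1 _ = _
      rw [funAction_tmul]
      exact one_smul _ _)
    (fun g g' => Induced.hom_ext h x ρ fun b v => by
      rw [Module.End.mul_apply]
      change funAction h x ρ (g * g') (Induced.tmul h x ρ b v) =
        funAction h x ρ g (funAction h x ρ g' (Induced.tmul h x ρ b v))
      rw [funAction_tmul, funAction_tmul, map_smul, funAction_tmul]
      rw [smul_smul, mul_comm (g'.eval _)]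
      rfl)

/-- The action of `F` on the induced module, `a [b ⊗ v] = [a b ⊗ v]`. -/
def groupAction : F →* Module.End E (Induced h x ρ) :=
  Representation.ind (stab h x).subtype ρ

theorem groupAction_tmul (a b : F) (v : V) :
    groupAction h x ρ a (Induced.tmul h x ρ b v) = Induced.tmul h x ρ (a * b) v := by
  have := Representation.ind_mk (stab h x).subtype ρ a b⁻¹ v
  rw [← mul_inv_rev] at this
  exact this

/-- The algebra homomorphism `H_E → End_E(V̂)` giving the action of the bismash product. -/
def inducedAction : Bismash h E →ₐ[E] Module.End E (Induced h x ρ) :=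
  SkewMonoidAlgebra.liftNCAlgHom (funActionHom h x ρ) (groupAction h x ρ) fun {g a} =>
    Induced.hom_ext h x ρ fun b v => by
      rw [Module.End.mul_apply, Module.End.mul_apply]
      change funAction h x ρ (a • g) (groupAction h x ρ a (Induced.tmul h x ρ b v)) =
        groupAction h x ρ a (funAction h x ρ g (Induced.tmul h x ρ b v))
      rw [groupAction_tmul, funAction_tmul, funAction_tmul, map_smul, groupAction_tmul]
      change g.eval (act h (act h x (a * b)⁻¹) a) • _ = _
      rw [← act_mul, mul_inv_rev, inv_mul_cancel_right]

instance : Module (Bismash h E) (Induced h x ρ) :=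
  Module.compHom _ (inducedAction h x ρ).toRingHom

/-- `(p_y # a) [b ⊗ v] = δ_{y ◁ (a b), x} [a b ⊗ v]`. -/
theorem basisElt_smul_tmul (y : G) (a b : F) (v : V) :
    basisElt h E y a • Induced.tmul h x ρ b v =
      if act h y (a * b) = x then Induced.tmul h x ρ (a * b) v else 0 := by
  have h1 : inducedAction h x ρ (basisElt h E y a) =
      funAction h x ρ (delta h E y) * groupAction h x ρ a :=
    SkewMonoidAlgebra.liftNC_single _ _ _ _
  change inducedAction h x ρ (basisElt h E y a) _ = _
  rw [h1, Module.End.mul_apply, groupAction_tmul, funAction_tmul]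
  have h2 : act h x (a * b)⁻¹ = y ↔ act h y (a * b) = x := by
    constructor
    · rintro rfl
      rw [← act_mul, inv_mul_cancel, act_one]
    · rintro rfl
      rw [← act_mul, mul_inv_cancel, act_one]
  simp only [FunAlg.eval, delta, h2]
  split_ifs <;> simp

end Induced

/-! ### Characters and Brauer characters -/

/-- The `p`-regular elements of a group. -/
def PRegular (p : ℕ) (Γ : Type*) [Group Γ] : Type _ := {g : Γ // (orderOf g).Coprime p}

section Brauer

variable {A Ω κ : Type*} [CommRing A] [CommRing Ω] [Algebra A Ω] [Field κ]

/-- The lift to `Ω` of `ζ ∈ κ`: the image in `Ω` of the root of unity of order prime to `p` in `A`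
which `f : A → κ` maps to `ζ` (and `0` if there is none). -/
def rootLift (p : ℕ) (f : A →+* κ) (Ω : Type*) [CommRing Ω] [Algebra A Ω] (ζ : κ) : Ω :=
  if hζ : ∃ ξ : A, (∃ n : ℕ, n.Coprime p ∧ ξ ^ n = 1) ∧ f ξ = ζ
  then algebraMap A Ω hζ.choose else 0

/-- The Brauer character of a finite-dimensional representation `σ` over `k`: on a `p`-regular `g`,
the sum of the lifts of the eigenvalues of `g`, with multiplicity, in the extension `κ` of `k`. -/
def brauerChar (p : ℕ) (f : A →+* κ) (Ω : Type*) [CommRing Ω] [Algebra A Ω]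
    {k : Type*} [Field k] [Algebra k κ] {Γ : Type*} [Group Γ] {W : Type*} [AddCommGroup W]
    [Module k W] [FiniteDimensional k W] (σ : Representation k Γ W) (g : PRegular p Γ) : Ω :=
  (((σ g.1).charpoly.aroots κ).map (rootLift p f Ω)).sum

end Brauer

section HatCharacters

variable {Q : Type w} [Group Q] {F G : Subgroup Q} (h : F.IsComplement' G)

/-- The index set of `B_{p'} = {p_y # a | a ∈ F_y, a is p-regular}`. -/
def BReg (p : ℕ) : Type w := {z : G × F // z.2 ∈ stab h z.1 ∧ (orderOf z.2).Coprime p}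

variable {h}

/-- The restriction to `B_{p'}` of the character of the `H_E`-module `V̂`. -/
def hatChar {E : Type u} [Field E] (p : ℕ) (x : G) {V : Type u} [AddCommGroup V] [Module E V]
    (ρ : Representation E (stab h x) V) (z : BReg h p) : E :=
  LinearMap.trace E (Induced h x ρ) (inducedAction h x ρ (basisElt h E z.1.1 z.1.2))

theorem coprime_conj {p : ℕ} {x : G} (z : BReg h p) (t : F)
    (ht : t⁻¹ * z.1.2 * t ∈ stab h x) :
    (orderOf (⟨t⁻¹ * z.1.2 * t, ht⟩ : stab h x)).Coprime p := by
  rw [Subgroup.orderOf_mk]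
  have := orderOf_injective (MulAut.conj t⁻¹).toMonoidHom (MulAut.conj t⁻¹).injective z.1.2
  simp only [MulEquiv.coe_toMonoidHom, MulAut.conj_apply, inv_inv] at this
  rw [this]
  exact z.2.2

/-- The function `φ̂` on `B_{p'}` obtained from a function `φ` on the `p`-regular elements of `F_x`,
`φ̂ (p_y # a) = ∑ δ_{y ◁ t, x} φ (t⁻¹ a t)` over the `t ∈ T` with `t⁻¹ a t ∈ F_x`. If `φ` is the
Brauer character of a simple `k F_x`-module `W` and `T` a set of representatives of the cosets
`t F_x`, this is the Brauer character of the simple `H_k`-module `Ŵ`. -/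
def hatBrauer {Ω : Type*} [CommRing Ω] {p : ℕ} {x : G} (T : Finset F)
    (φ : PRegular p (stab h x) → Ω) (z : BReg h p) : Ω :=
  ∑ t ∈ T, if ht : t⁻¹ * z.1.2 * t ∈ stab h x then
    (if act h z.1.1 t = x then φ ⟨⟨t⁻¹ * z.1.2 * t, ht⟩, coprime_conj z t ht⟩ else 0) else 0

end HatCharacters

/-- `D` is a decomposition matrix of the `K`-valued functions `χ i` with respect to the functions
`φ j`, with values in an extension `Ω` of `K`: its entries are integers and
`χ i = ∑ j, D i j φ j`. -/
def IsDecompositionMatrix {X K Ω ι κ : Type*} [Fintype κ] [CommRing K] [CommRing Ω] [Algebra K Ω]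
    (χ : ι → X → K) (φ : κ → X → Ω) (D : Matrix ι κ ℤ) : Prop :=
  ∀ i z, algebraMap K Ω (χ i z) = ∑ j, (D i j : Ω) * φ j z

end BismashProduct

end

/-! The idempotents `p_y` cut an `H_E`-module `U` into components `p_y U`, and `p_y # a` links
components along an orbit of `F`. The corner `p_x H_E p_x` is spanned by the `p_x # a` with `a ∈
F_x`, so it acts on `p_x U` through the group algebra of `F_x`. If `U` is simple and `p_x U ≠ 0`,
then `p_x U` is irreducible and `U` is induced from it. Conversely `V` is recovered from `V̂` as
`p_x V̂ = 1 ⊗ V`. This classifies the simple modules over any field.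

For `a ∈ F_y`, the operator `p_y # a` on `V̂` has image inside the single summand `t ⊗ V` with `y ◁
t = x`, and its trace is `χ(t⁻¹ a t)`. Thus `χ̂` and `φ̂` arise from `χ` and `φ` by the same
operation, `hatBrauer`. It is linear and injective, and its values are supported on the `p_y # a`
with `y` in the orbit of `x`. Linearity and injectivity give the same decomposition matrices
upstairs and downstairs; disjointness of the supports for different orbits gives the block diagonal
form.

There remains the classical theory for the groups `F_x`. Existence of decomposition numbers: an
ordinary representation has a stable `R`-lattice, its reduction has the restricted character as
Brauer character, and Brauer characters add along composition series. Uniqueness is independence of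
the irreducible Brauer characters over `ℤ`. Modulo the prime they become traces, which are linearly
independent over the finite field `k`, so the coefficients of an integral relation are divisible by
`p`; dividing by `p` and repeating forces them to vanish. -/

namespace BismashProduct

open scoped Classical

/-! ### The distinguished basis spans the bismash product -/

section Spanning

variable {Q : Type w} [Group Q] {F G : Subgroup Q} (h : F.IsComplement' G)
  {E : Type u} [Field E]

theorem act_eq_iff (x y : G) (a : F) : act h y a = x ↔ y = act h x a⁻¹ := by
  constructor
  · rintro rfl
    rw [← act_mul, mul_inv_cancel, act_one]
  · rintro rfl
    rw [← act_mul, inv_mul_cancel, act_one]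

theorem single_eq_sum_basisElt [Fintype G] (a : F) (g : FunAlg h E) :
    (SkewMonoidAlgebra.single a g : Bismash h E) = ∑ y : G, g.eval y • basisElt h E y a := by
  have : g = ∑ y : G, g.eval y • delta h E y := by
    funext z
    have h1 : ∀ (s : Finset G), (∑ y ∈ s, g.eval y • delta h E y : FunAlg h E) z =
        ∑ y ∈ s, g.eval y * delta h E y z := by
      intro s
      exact Finset.sum_apply z s (fun y => (g.eval y • delta h E y : G → E))
    rw [h1]
    rw [Finset.sum_eq_single z (fun y _ hy => by simp [delta, Ne.symm hy]) (by simp)]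
    simp [delta, FunAlg.eval]
  conv_lhs => rw [this]
  simp only [basisElt, SkewMonoidAlgebra.smul_single]
  exact map_sum (SkewMonoidAlgebra.singleAddHom a) _ _

theorem sum_basisElt_one [Fintype G] : ∑ y : G, basisElt h E y 1 = 1 := by
  have := single_eq_sum_basisElt h (1 : F) (1 : FunAlg h E)
  rw [SkewMonoidAlgebra.single_one_one] at this
  rw [this]
  exact Finset.sum_congr rfl fun y _ => (one_smul E _).symm

@[elab_as_elim]
theorem bismash_induction [Finite G] {P : Bismash h E → Prop} (α : Bismash h E)
    (hb : ∀ y a, P (basisElt h E y a)) (h0 : P 0) (hadd : ∀ α β, P α → P β → P (α + β))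
    (hsmul : ∀ (r : E) α, P α → P (r • α)) : P α := by
  have := Fintype.ofFinite G
  refine SkewMonoidAlgebra.induction_on α h0 (fun a g => ?_) (fun {α β} => hadd α β)
  rw [single_eq_sum_basisElt]
  exact Finset.sum_induction _ P hadd h0 fun y _ => hsmul _ _ (hb y a)

end Spanning

/-! ### Structure of the induced modules -/

section Induced

variable {Q : Type w} [Group Q] {F G : Subgroup Q} (h : F.IsComplement' G)
  {E : Type u} [Field E] (x : G) {V : Type u} [AddCommGroup V] [Module E V]
  (ρ : Representation E (stab h x) V)

theorem Induced.tmul_mul (b : F) (s : stab h x) (v : V) :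
    Induced.tmul h x ρ (b * s) v = Induced.tmul h x ρ b (ρ s v) := by
  have := Representation.Coinvariants.mk_self_apply
    (Representation.tprod ((Representation.leftRegular E F).comp (stab h x).subtype) ρ) s
    (TensorProduct.tmul E (MonoidAlgebra.single (b * s)⁻¹ (1 : E)) v)
  simp only [Representation.tprod_apply, TensorProduct.map_tmul] at this
  change Representation.Coinvariants.mk _ (TensorProduct.tmul E _ v) =
    Representation.Coinvariants.mk _ (TensorProduct.tmul E _ (ρ s v))
  rw [← this]
  simp

theorem Induced.linearMap_ext {M : Type*} [AddCommGroup M] [Module E M]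
    {f g : Induced h x ρ →ₗ[E] M}
    (hfg : ∀ (b : F) (v : V), f (Induced.tmul h x ρ b v) = g (Induced.tmul h x ρ b v)) :
    f = g := by
  refine Representation.IndV.hom_ext (stab h x).subtype ρ (B := M) fun c => ?_
  ext v
  have := hfg c⁻¹ v
  rwa [Induced.tmul, inv_inv] at this

/-- The linear map out of `V̂` given by a compatible family of linear maps out of `V`. -/
noncomputable def Induced.lift {M : Type*} [AddCommGroup M] [Module E M] (φ : F → V →ₗ[E] M)
    (hφ : ∀ (b : F) (s : stab h x) (v : V), φ (b * s) v = φ b (ρ s v)) :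
    Induced h x ρ →ₗ[E] M :=
  Representation.Coinvariants.lift _
    (TensorProduct.lift ((MonoidAlgebra.basis F E).constr E fun c => φ c⁻¹)) fun s => by
      refine TensorProduct.ext ?_
      refine (MonoidAlgebra.basis F E).ext fun c => ?_
      ext v
      simp only [MonoidAlgebra.basis_apply, TensorProduct.mk_apply,
        LinearMap.comp_apply, Representation.tprod_apply, TensorProduct.map_tmul,
        TensorProduct.lift.tmul, LinearMap.compr₂ₛₗ_apply]
      have h1 : ((Representation.leftRegular E F).comp (stab h x).subtype) s
          (MonoidAlgebra.single c (1 : E)) = (MonoidAlgebra.basis F E) ((s : F) * c) := by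
        simp
      rw [h1, ← MonoidAlgebra.basis_apply, Module.Basis.constr_basis, Module.Basis.constr_basis,
        ← hφ]
      simp

theorem Induced.lift_tmul {M : Type*} [AddCommGroup M] [Module E M] (φ : F → V →ₗ[E] M)
    (hφ : ∀ (b : F) (s : stab h x) (v : V), φ (b * s) v = φ b (ρ s v)) (b : F) (v : V) :
    Induced.lift h x ρ φ hφ (Induced.tmul h x ρ b v) = φ b v := by
  change TensorProduct.lift ((MonoidAlgebra.basis F E).constr E fun c => φ c⁻¹)
    (TensorProduct.tmul E (MonoidAlgebra.single b⁻¹ (1 : E)) v) = _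
  rw [TensorProduct.lift.tmul, ← MonoidAlgebra.basis_apply, Module.Basis.constr_basis, inv_inv]

/-- The projection of `V̂` onto its component `1 ⊗ V`. -/
noncomputable def Induced.proj : Induced h x ρ →ₗ[E] V :=
  Induced.lift h x ρ (fun b => if hb : b ∈ stab h x then ρ ⟨b, hb⟩ else 0) fun b s v => by
    by_cases hb : b ∈ stab h x
    · have hbs : b * s ∈ stab h x := mul_mem hb s.2
      rw [dif_pos hb, dif_pos hbs, ← Module.End.mul_apply, ← map_mul]
      rfl
    · have hbs : b * s ∉ stab h x := fun hbs => hb ((Subgroup.mul_mem_cancel_right _ s.2).1 hbs)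
      rw [dif_neg hb, dif_neg hbs]
      rfl

theorem Induced.proj_tmul (b : F) (v : V) (hb : b ∈ stab h x) :
    Induced.proj h x ρ (Induced.tmul h x ρ b v) = ρ ⟨b, hb⟩ v := by
  rw [Induced.proj, Induced.lift_tmul, dif_pos hb]

theorem Induced.proj_tmul_of_notMem (b : F) (v : V) (hb : b ∉ stab h x) :
    Induced.proj h x ρ (Induced.tmul h x ρ b v) = 0 := by
  rw [Induced.proj, Induced.lift_tmul, dif_neg hb]
  rfl

theorem Induced.proj_tmul_one (v : V) :
    Induced.proj h x ρ (Induced.tmul h x ρ 1 v) = v := by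
  rw [Induced.proj_tmul h x ρ 1 v (one_mem _)]
  exact congrArg (fun f : Module.End E V => f v) (map_one ρ)

instance : IsScalarTower E (Bismash h E) (Induced h x ρ) where
  smul_assoc r α m := by
    change inducedAction h x ρ (r • α) m = r • inducedAction h x ρ α m
    rw [map_smul, LinearMap.smul_apply]

theorem inducedAction_apply (α : Bismash h E) (m : Induced h x ρ) :
    inducedAction h x ρ α m = α • m := rfl

/-- If `y ◁ b = x`, then `p_y # a` maps `V̂` to `b ⊗ V`. -/
theorem basisElt_smul_of_act_eq (y : G) (a b : F) (hb : act h y b = x) (m : Induced h x ρ) :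
    basisElt h E y a • m =
      Induced.tmul h x ρ b (Induced.proj h x ρ (groupAction h x ρ (b⁻¹ * a) m)) := by
  suffices H : inducedAction h x ρ (basisElt h E y a) =
      Induced.tmul h x ρ b ∘ₗ Induced.proj h x ρ ∘ₗ groupAction h x ρ (b⁻¹ * a) from
    LinearMap.congr_fun H m
  refine Induced.linearMap_ext h x ρ fun c v => ?_
  rw [inducedAction_apply, basisElt_smul_tmul, LinearMap.comp_apply, LinearMap.comp_apply,
    groupAction_tmul]
  -- Since `y = x ◁ b⁻¹`, the condition on `y` becomes one on `x`.
  have key : act h y (a * c) = x ↔ b⁻¹ * a * c ∈ stab h x := by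
    change _ ↔ act h x _ = x
    conv_rhs => rw [mul_assoc, act_mul, (act_eq_iff h x y b).1 hb |>.symm]
  by_cases hc : b⁻¹ * a * c ∈ stab h x
  · rw [if_pos (key.2 hc), Induced.proj_tmul h x ρ _ v hc, ← Induced.tmul_mul]
    simp [mul_assoc]
  · rw [if_neg (mt key.1 hc), Induced.proj_tmul_of_notMem h x ρ _ v hc, map_zero]

/-- If `y` is not in the orbit of `x`, then `p_y # a` acts as zero on `V̂`. -/
theorem basisElt_smul_of_forall_ne (y : G) (a : F) (hy : ∀ b, act h y b ≠ x)
    (m : Induced h x ρ) : basisElt h E y a • m = 0 := by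
  suffices H : inducedAction h x ρ (basisElt h E y a) = 0 from LinearMap.congr_fun H m
  refine Induced.linearMap_ext h x ρ fun c v => ?_
  rw [inducedAction_apply, basisElt_smul_tmul, if_neg (hy _)]
  rfl

theorem basisElt_smul_self (a : F) (m : Induced h x ρ) :
    basisElt h E x a • m =
      Induced.tmul h x ρ 1 (Induced.proj h x ρ (groupAction h x ρ a m)) := by
  rw [basisElt_smul_of_act_eq h x ρ x a 1 (act_one h x), inv_one, one_mul]

variable (E) in
theorem sum_basisElt_one_smul [Fintype G] {U : Type*} [AddCommGroup U] [Module (Bismash h E) U]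
    (m : U) : ∑ y : G, basisElt h E y 1 • m = m := by
  rw [← Finset.sum_smul, sum_basisElt_one, one_smul]

variable (E) in
theorem exists_basisElt_one_smul_ne_zero [Finite G] {U : Type*} [AddCommGroup U]
    [Module (Bismash h E) U] {m : U} (hm : m ≠ 0) : ∃ y : G, basisElt h E y 1 • m ≠ 0 := by
  have := Fintype.ofFinite G
  by_contra! hc
  exact hm (by rw [← sum_basisElt_one_smul h E m]; exact Finset.sum_eq_zero fun y _ => hc y)

/-- The `p_y` sum to `1`, so some `p_y m` is nonzero. It lies in `b ⊗ V` with `y ◁ b = x`, and its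
coordinate there is the projection of `b⁻¹ m`. -/
theorem Induced.exists_proj_ne_zero [Finite G] {m : Induced h x ρ} (hm : m ≠ 0) :
    ∃ b : F, Induced.proj h x ρ (groupAction h x ρ b m) ≠ 0 := by
  obtain ⟨y, hy⟩ := exists_basisElt_one_smul_ne_zero h E hm
  by_cases hb : ∃ b, act h y b = x
  · obtain ⟨b, hb⟩ := hb
    refine ⟨b⁻¹ * 1, fun h0 => hy ?_⟩
    rw [basisElt_smul_of_act_eq h x ρ y 1 b hb, h0, map_zero]
  · push Not at hb
    exact absurd (basisElt_smul_of_forall_ne h x ρ y 1 hb m) hy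

/-- The set of `v` with `1 ⊗ v` in a given submodule of `V̂`. -/
noncomputable def Induced.subrep (N : Submodule (Bismash h E) (Induced h x ρ)) : Subrepresentation ρ where
  toSubmodule := (N.restrictScalars E).comap (Induced.tmul h x ρ 1)
  apply_mem_toSubmodule s v hv := by
    change Induced.tmul h x ρ 1 (ρ s v) ∈ N
    have hv' : Induced.tmul h x ρ 1 v ∈ N := hv
    have := N.smul_mem (basisElt h E x s) hv'
    rwa [basisElt_smul_self, groupAction_tmul, mul_one, Induced.proj_tmul h x ρ s v s.2] at this

theorem Induced.mem_subrep (N : Submodule (Bismash h E) (Induced h x ρ)) (v : V) :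
    v ∈ Induced.subrep h x ρ N ↔ Induced.tmul h x ρ 1 v ∈ N := Iff.rfl

theorem Induced.eq_top_of_forall_tmul_mem (N : Submodule (Bismash h E) (Induced h x ρ))
    (hN : ∀ b v, Induced.tmul h x ρ b v ∈ N) : N = ⊤ := by
  have h1 : (N.restrictScalars E).mkQ = 0 := Induced.linearMap_ext h x ρ fun b v => by
    simpa using hN b v
  rw [eq_top_iff]
  intro m _
  have := LinearMap.congr_fun h1 m
  simpa using this

theorem Induced.nontrivial_of [Nontrivial V] : Nontrivial (Induced h x ρ) := by
  obtain ⟨v, hv⟩ := exists_ne (0 : V)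
  refine ⟨Induced.tmul h x ρ 1 v, 0, fun h0 => hv ?_⟩
  rw [← Induced.proj_tmul_one h x ρ v, h0, map_zero]

theorem _root_.Representation.IsIrreducible.nontrivial' {Γ : Type*} [Monoid Γ] {V : Type*}
    [AddCommGroup V] [Module E V] {ρ : Representation E Γ V} (hρ : ρ.IsIrreducible) :
    Nontrivial V := by
  by_contra hV
  rw [not_nontrivial_iff_subsingleton] at hV
  obtain ⟨a, b, hab⟩ := hρ.toNontrivial
  exact hab (SetLike.ext fun v => by
    rw [Subsingleton.elim v 0]
    exact ⟨fun _ => b.toSubmodule.zero_mem, fun _ => a.toSubmodule.zero_mem⟩)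

/-- The module induced from an irreducible representation is simple. -/
theorem Induced.isSimpleModule [Finite G] (hρ : ρ.IsIrreducible) :
    IsSimpleModule (Bismash h E) (Induced h x ρ) := by
  have := hρ.nontrivial'
  have := Induced.nontrivial_of h x ρ
  rw [isSimpleModule_iff]
  refine ⟨fun N => ?_⟩
  by_cases hN : N = ⊥
  · exact Or.inl hN
  right
  obtain ⟨m, hm, hm0⟩ := N.ne_bot_iff.1 hN
  obtain ⟨b, hb⟩ := Induced.exists_proj_ne_zero h x ρ hm0
  -- Applying `p_x # b` to `m` puts this nonzero vector, as `1 ⊗ v`, into `N`; irreducibility then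
  -- puts all of `1 ⊗ V` there.
  have hmem : Induced.proj h x ρ (groupAction h x ρ b m) ∈ Induced.subrep h x ρ N := by
    rw [Induced.mem_subrep, ← basisElt_smul_self]
    exact N.smul_mem _ hm
  have htop : Induced.subrep h x ρ N = ⊤ := by
    refine (hρ.eq_bot_or_eq_top _).resolve_left fun h0 => hb ?_
    rw [h0] at hmem
    exact (Submodule.mem_bot E).1 hmem
  refine Induced.eq_top_of_forall_tmul_mem h x ρ N fun c v => ?_
  have hv : Induced.tmul h x ρ 1 v ∈ N := by
    rw [← Induced.mem_subrep, htop]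
    exact Submodule.mem_top (R := E)
  -- This basis element carries `1 ⊗ v` to `c ⊗ v`.
  have := N.smul_mem (basisElt h E (act h x c⁻¹) c) hv
  rwa [basisElt_smul_tmul, mul_one, if_pos ((act_eq_iff h x _ c).2 rfl)] at this

/-- Modules induced from different orbits are not isomorphic. -/
theorem Induced.exists_act_eq_of_equiv [Nontrivial V] {x' : G} {V' : Type u} [AddCommGroup V']
    [Module E V'] (ρ' : Representation E (stab h x') V')
    (e : Induced h x ρ ≃ₗ[Bismash h E] Induced h x' ρ') : ∃ b, act h x b = x' := by
  by_contra! hc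
  obtain ⟨v, hv⟩ := exists_ne (0 : V)
  -- The idempotent `p_x` fixes `1 ⊗ v` but kills the second module when `x'` is outside the orbit
  -- of `x`.
  have h1 : basisElt h E x 1 • Induced.tmul h x ρ 1 v = Induced.tmul h x ρ 1 v := by
    rw [basisElt_smul_tmul, mul_one, if_pos (act_one h x)]
  have h2 := congrArg e h1
  rw [map_smul, basisElt_smul_of_forall_ne h x' ρ' x 1 hc, eq_comm, e.map_eq_zero_iff] at h2
  exact hv (by rw [← Induced.proj_tmul_one h x ρ v, h2, map_zero])

/-- A homomorphism of induced modules gives a homomorphism of representations. -/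
noncomputable def Induced.restrictHom {V' : Type u} [AddCommGroup V'] [Module E V']
    (ρ' : Representation E (stab h x) V')
    (e : Induced h x ρ →ₗ[Bismash h E] Induced h x ρ') : ρ.IntertwiningMap ρ' :=
  LinearMap.intertwiningMap_of_isIntertwiningMap ρ ρ'
    (Induced.proj h x ρ' ∘ₗ e.restrictScalars E ∘ₗ Induced.tmul h x ρ 1) fun s v => by
      simp only [LinearMap.comp_apply, LinearMap.coe_restrictScalars]
      have h1 : ∀ s : stab h x, basisElt h E x s • Induced.tmul h x ρ 1 v =
          Induced.tmul h x ρ 1 (ρ s v) := fun s => by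
        rw [basisElt_smul_self, groupAction_tmul, mul_one, Induced.proj_tmul h x ρ _ v s.2]
      have h2 : basisElt h E x 1 • Induced.tmul h x ρ 1 v = Induced.tmul h x ρ 1 v := by
        rw [basisElt_smul_tmul, mul_one, if_pos (act_one h x)]
      -- As `e` commutes with `p_x`, it maps `1 ⊗ V` into `1 ⊗ V'`.
      have hm : e (Induced.tmul h x ρ 1 v) =
          Induced.tmul h x ρ' 1 (Induced.proj h x ρ' (e (Induced.tmul h x ρ 1 v))) := by
        conv_lhs => rw [← h2, map_smul, basisElt_smul_self h x ρ' 1, map_one]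
        rfl
      rw [← h1 s, map_smul, basisElt_smul_self h x ρ', Induced.proj_tmul_one]
      conv_lhs => rw [hm, groupAction_tmul, mul_one, Induced.proj_tmul h x ρ' _ _ s.2]

theorem Induced.tmul_restrictHom {V' : Type u} [AddCommGroup V'] [Module E V']
    (ρ' : Representation E (stab h x) V')
    (e : Induced h x ρ →ₗ[Bismash h E] Induced h x ρ') (v : V) :
    Induced.tmul h x ρ' 1 (Induced.restrictHom h x ρ ρ' e v) = e (Induced.tmul h x ρ 1 v) := by
  have h2 : basisElt h E x 1 • Induced.tmul h x ρ 1 v = Induced.tmul h x ρ 1 v := by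
    rw [basisElt_smul_tmul, mul_one, if_pos (act_one h x)]
  conv_rhs => rw [← h2, map_smul, basisElt_smul_self h x ρ' 1, map_one]
  rfl

/-- Schur's lemma for the restriction of `e` to `1 ⊗ V`, which is nonzero because `e` is injective.
-/
theorem Induced.nonempty_equiv_of_equiv {V' : Type u} [AddCommGroup V'] [Module E V']
    (ρ' : Representation E (stab h x) V') (hρ : ρ.IsIrreducible) (hρ' : ρ'.IsIrreducible)
    (e : Induced h x ρ ≃ₗ[Bismash h E] Induced h x ρ') : Nonempty (ρ.Equiv ρ') := by
  have := hρ.nontrivial'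
  rcases Representation.IsIrreducible.bijective_or_eq_zero
    (Induced.restrictHom h x ρ ρ' e.toLinearMap) with hb | h0
  · exact ⟨Representation.IntertwiningMap.ofBijective _ hb⟩
  · obtain ⟨v, hv⟩ := exists_ne (0 : V)
    refine absurd ?_ hv
    have h1 := Induced.tmul_restrictHom h x ρ ρ' e.toLinearMap v
    rw [h0] at h1
    have h2 : e (Induced.tmul h x ρ 1 v) = 0 := by
      refine Eq.trans h1.symm ?_
      exact map_zero _
    rw [e.map_eq_zero_iff] at h2
    rw [← Induced.proj_tmul_one h x ρ v, h2, map_zero]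

end Induced

end BismashProduct

/-! ### Components of a module and the classification of simple modules -/

namespace BismashProduct

open scoped Classical

/-- If `x ◁ a = y`, then `p_y = (p_y # a⁻¹)(p_x # a)`, so the components at `x` and `y` vanish
together. -/
theorem exists_basisElt_smul_ne_zero_of_act_eq {Q : Type w} [Group Q] {F G : Subgroup Q}
    (h : F.IsComplement' G) (E : Type u) [Field E] (x : G) {U : Type*} [AddCommGroup U]
    [Module (Bismash h E) U] {y : G} (a : F) (hy : act h x a = y)
    (u : U) (hu : basisElt h E y 1 • u ≠ 0) : ∃ u' : U, basisElt h E x 1 • u' ≠ 0 := by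
  refine ⟨basisElt h E x a • u, fun h0 => hu ?_⟩
  rw [smul_smul, basisElt_mul, act_one, if_pos rfl, one_mul] at h0
  have : basisElt h E y 1 • u = basisElt h E y a⁻¹ • basisElt h E x a • u := by
    rw [smul_smul, basisElt_mul, if_pos, inv_mul_cancel]
    exact (act_eq_iff h _ _ _).1 hy
  rw [this, h0, smul_zero]

section Component

variable {Q : Type w} [Group Q] {F G : Subgroup Q} (h : F.IsComplement' G)
  (E : Type u) [Field E] (x : G) (U : Type*) [AddCommGroup U] [Module E U]
  [Module (Bismash h E) U] [IsScalarTower E (Bismash h E) U]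

/-- The component `p_x U` of an `H_E`-module `U`. -/
def component : Submodule E U where
  carrier := {u | basisElt h E x 1 • u = u}
  add_mem' {a b} ha hb := by
    change _ • _ = _
    rw [smul_add, ha, hb]
  zero_mem' := smul_zero _
  smul_mem' r u hu := by
    change _ • _ = _
    rw [smul_comm, hu]

variable {U}

theorem mem_component (u : U) : u ∈ component h E x U ↔ basisElt h E x 1 • u = u := Iff.rfl

theorem basisElt_smul_mem_component (a : F) (u : U) :
    basisElt h E x a • u ∈ component h E x U := by
  rw [mem_component, smul_smul, basisElt_mul, act_one, if_pos rfl, one_mul]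

variable (U)

/-- The representation of `F_x` on the component `p_x U` of an `H_E`-module `U`. -/
noncomputable def componentRep : Representation E (stab h x) (component h E x U) where
  toFun s := ((Algebra.lsmul E E U (basisElt h E x s)).domRestrict _).codRestrict _
    fun u => basisElt_smul_mem_component h E x s (u : U)
  map_one' := by
    ext u
    exact u.2
  map_mul' s t := by
    ext u
    change basisElt h E x (s * t : F) • (u : U) = basisElt h E x s • basisElt h E x t • (u : U)
    rw [smul_smul, basisElt_mul, if_pos]
    exact s.2.symm

variable {U}

theorem coe_componentRep (s : stab h x) (u : component h E x U) :
    (componentRep h E x U s u : U) = basisElt h E x s • (u : U) := rfl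

/-- Because `u = p_x u`, only the corner `p_x H_E p_x` matters, and `p_x (p_y # a) p_x` is zero
unless `y = x` and `a ∈ F_x`. -/
theorem basisElt_smul_mem_of_mem_subrep (S : Subrepresentation (componentRep h E x U))
    (α : Bismash h E) [Finite G] (u : component h E x U) (hu : u ∈ S) :
    ∃ v ∈ S, basisElt h E x 1 • α • (u : U) = (v : U) := by
  induction α using bismash_induction with
  | hb y a =>
    by_cases hy : y = x ∧ a ∈ stab h x
    · obtain ⟨rfl, ha⟩ := hy
      refine ⟨_, S.apply_mem_toSubmodule ⟨a, ha⟩ hu, ?_⟩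
      rw [smul_smul, basisElt_mul, act_one, if_pos rfl, one_mul]
      rfl
    · refine ⟨0, S.toSubmodule.zero_mem, ?_⟩
      rw [← u.2, smul_smul, smul_smul, basisElt_mul, act_one]
      by_cases hyx : y = x
      · rw [if_pos hyx, basisElt_mul, if_neg, zero_smul]
        · rfl
        · exact fun h0 => hy ⟨hyx, by rw [one_mul] at h0; exact h0.symm⟩
      · rw [if_neg hyx, zero_mul, zero_smul]
        rfl
  | h0 => exact ⟨0, S.toSubmodule.zero_mem, by simp⟩
  | hadd α β hα hβ =>
    obtain ⟨v, hv, hv'⟩ := hα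
    obtain ⟨w, hw, hw'⟩ := hβ
    exact ⟨v + w, S.toSubmodule.add_mem hv hw, by rw [add_smul, smul_add, hv', hw']; rfl⟩
  | hsmul r α hα =>
    obtain ⟨v, hv, hv'⟩ := hα
    exact ⟨r • v, S.toSubmodule.smul_mem r hv, by rw [smul_assoc, smul_comm, hv']; rfl⟩

/-- A nonzero `w ∈ S` generates the simple module `U`, so any `u ∈ p_x U` is `α w` for some `α`, and
`u = p_x α w` lies in `S`. -/
theorem componentRep_isIrreducible [Finite G] [IsSimpleModule (Bismash h E) U]
    (hx : ∃ u : U, basisElt h E x 1 • u ≠ 0) : (componentRep h E x U).IsIrreducible := by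
  obtain ⟨u₀, hu₀⟩ := hx
  have hnt : Nontrivial (Subrepresentation (componentRep h E x U)) := by
    refine ⟨⟨⊥, ⊤, fun h0 => hu₀ ?_⟩⟩
    have : (⟨_, basisElt_smul_mem_component h E x 1 u₀⟩ : component h E x U) ∈
        (⊤ : Subrepresentation (componentRep h E x U)) := Submodule.mem_top (R := E)
    rw [← h0] at this
    exact congrArg Subtype.val ((Submodule.mem_bot E).1 this)
  refine ⟨fun S => ?_⟩
  by_cases hS : S = ⊥
  · exact Or.inl hS
  right
  have : ∃ w ∈ S, w ≠ 0 := by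
    by_contra! hc
    refine hS (SetLike.ext fun w => ⟨fun hw => ?_, fun hw => ?_⟩)
    · rw [hc w hw]
      exact (Submodule.mem_bot E).2 rfl
    · rw [(Submodule.mem_bot E).1 hw]
      exact S.toSubmodule.zero_mem
  obtain ⟨w, hw, hw0⟩ := this
  refine SetLike.ext fun u => ⟨fun _ => Submodule.mem_top (R := E), fun _ => ?_⟩
  have hw0' : (w : U) ≠ 0 := fun h0 => hw0 (Subtype.ext h0)
  obtain ⟨α, hα⟩ := (IsSimpleModule.toSpanSingleton_surjective (Bismash h E) hw0') (u : U)
  obtain ⟨v, hv, hv'⟩ := basisElt_smul_mem_of_mem_subrep h E x S α w hw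
  have : u = v := Subtype.ext (by
    rw [← hv', ← u.2, ← hα]
    rfl)
  rwa [this]

/-- The action of `a ∈ F` on an `H_E`-module. -/
noncomputable def groupSMul (a : F) : U →ₗ[E] U :=
  Algebra.lsmul E E U (SkewMonoidAlgebra.single a 1 : Bismash h E)

theorem groupSMul_apply (a : F) (u : U) :
    groupSMul h E a u = (SkewMonoidAlgebra.single a 1 : Bismash h E) • u := rfl

theorem single_mul_basisElt (a b : F) (y : G) :
    (SkewMonoidAlgebra.single a 1 : Bismash h E) * basisElt h E y b =
      basisElt h E (act h y a⁻¹) (a * b) := by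
  rw [basisElt, basisElt, SkewMonoidAlgebra.single_mul_single, one_mul]
  congr 1
  funext z
  change (if act h z a = y then (1 : E) else 0) = if z = act h y a⁻¹ then 1 else 0
  simp only [act_eq_iff]

theorem basisElt_mul_single (a b : F) (y : G) :
    basisElt h E y b * (SkewMonoidAlgebra.single a 1 : Bismash h E) = basisElt h E y (b * a) := by
  rw [basisElt, basisElt, SkewMonoidAlgebra.single_mul_single, smul_one, mul_one]

variable {V : Type u} [AddCommGroup V] [Module E V] (ρ : Representation E (stab h x) V)

/-- The linear map `V̂ → U`, `b ⊗ v ↦ b (g v)`, attached to a homomorphism `g` of representations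
from `V` to `p_x U`. -/
noncomputable def inducedHomAux (g : ρ.IntertwiningMap (componentRep h E x U)) :
    Induced h x ρ →ₗ[E] U :=
  Induced.lift h x ρ
    (fun b => groupSMul h E b ∘ₗ (component h E x U).subtype ∘ₗ g.toLinearMap) fun b s v => by
      have h1 : g.toLinearMap (ρ s v) = componentRep h E x U s (g.toLinearMap v) :=
        LinearMap.congr_fun (g.isIntertwining' s) v
      simp only [LinearMap.comp_apply, Submodule.subtype_apply, groupSMul_apply]
      rw [h1, coe_componentRep]
      -- Writing `g v` as `p_x (g v)` turns both sides into the action of `p_{x ◁ b⁻¹} # b s`.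
      conv_lhs => rw [← (mem_component h E x _).1 (g.toLinearMap v).2]
      rw [smul_smul, smul_smul, single_mul_basisElt, single_mul_basisElt, mul_one, mul_inv_rev,
        act_mul, show act h x (s : F)⁻¹ = x from inv_mem s.2]

theorem inducedHomAux_tmul (g : ρ.IntertwiningMap (componentRep h E x U)) (b : F) (v : V) :
    inducedHomAux h E x ρ g (Induced.tmul h x ρ b v) =
      (SkewMonoidAlgebra.single b 1 : Bismash h E) • (g v : U) :=
  Induced.lift_tmul ..

/-- The `H_E`-linear map `V̂ → U`, `b ⊗ v ↦ b (g v)`, attached to a homomorphism `g` of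
representations from `V` to `p_x U`. -/
noncomputable def inducedHom [Finite G] (g : ρ.IntertwiningMap (componentRep h E x U)) :
    Induced h x ρ →ₗ[Bismash h E] U where
  toFun := inducedHomAux h E x ρ g
  map_add' := map_add _
  map_smul' α m := by
    rw [RingHom.id_apply]
    induction α using bismash_induction with
    | hb y a =>
      suffices H : inducedHomAux h E x ρ g ∘ₗ inducedAction h x ρ (basisElt h E y a) =
          Algebra.lsmul E E U (basisElt h E y a) ∘ₗ inducedHomAux h E x ρ g from
        LinearMap.congr_fun H m
      refine Induced.linearMap_ext h x ρ fun b v => ?_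
      simp only [LinearMap.comp_apply, Algebra.lsmul_coe, inducedAction_apply, basisElt_smul_tmul]
      rw [inducedHomAux_tmul, smul_smul, basisElt_mul_single]
      have hv := (mem_component h E x _).1 (g v).2
      split_ifs with hc
      · rw [inducedHomAux_tmul, ← hv, smul_smul, smul_smul, single_mul_basisElt, basisElt_mul,
          if_pos hc.symm, (act_eq_iff h _ _ _).1 hc, mul_one]
      · rw [map_zero, ← hv, smul_smul, basisElt_mul, if_neg (Ne.symm hc), zero_smul]
    | h0 => simp
    | hadd α β hα hβ => rw [add_smul, map_add, hα, hβ, add_smul]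
    | hsmul r α hα => rw [smul_assoc, map_smul, hα, smul_assoc]

theorem inducedHom_tmul_one [Finite G] (g : ρ.IntertwiningMap (componentRep h E x U)) (v : V) :
    inducedHom h E x ρ g (Induced.tmul h x ρ 1 v) = (g v : U) := by
  refine (inducedHomAux_tmul h E x ρ g 1 v).trans ?_
  rw [SkewMonoidAlgebra.single_one_one, one_smul]

end Component

section Complete

variable {Q : Type w} [Group Q] [Finite Q] {F G : Subgroup Q} (h : F.IsComplement' G)
  {E : Type u} [Field E]

/-- The modules induced from the irreducible representations of the stabilizers of representatives
of the orbits are all the simple modules of the bismash product. -/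
theorem isCompleteSimples_induced {ι : Type*} (x : ι → G)
    (hx : ∀ y : G, ∃! q, ∃ a : F, act h (x q) a = y) {n : ι → Type*}
    {V : ∀ q, n q → Type u} [∀ q i, AddCommGroup (V q i)] [∀ q i, Module E (V q i)]
    (ρ : ∀ q i, Representation E (stab h (x q)) (V q i)) (hρ : ∀ q, IsCompleteIrreps (ρ q)) :
    IsCompleteSimples.{u} (Bismash h E)
      (fun e : Σ q, n q => Induced h (x e.1) (ρ e.1 e.2)) := by
  refine ⟨fun e => Induced.isSimpleModule h _ _ ((hρ e.1).1 e.2), ?_, ?_⟩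
  · rintro ⟨q, i⟩ ⟨q', i'⟩ ⟨e⟩
    have := ((hρ q).1 i).nontrivial'
    obtain ⟨b, hb⟩ := Induced.exists_act_eq_of_equiv h _ _ _ e
    have hq : q = q' := (hx (x q')).unique ⟨b, hb⟩ ⟨1, act_one h _⟩
    subst hq
    rw [(hρ q).2.1 i i' (Induced.nonempty_equiv_of_equiv h _ _ _ ((hρ q).1 i) ((hρ q).1 i') e)]
  · intro U _ _ hU
    let : Module E U := Module.compHom U (algebraMap E (Bismash h E))
    have : IsScalarTower E (Bismash h E) U :=
      IsScalarTower.of_algebraMap_smul fun r m => rfl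
    have : Nontrivial U := IsSimpleModule.nontrivial (Bismash h E) U
    obtain ⟨u, hu⟩ := exists_ne (0 : U)
    obtain ⟨y, hy⟩ := exists_basisElt_one_smul_ne_zero h E hu
    obtain ⟨q, ⟨a, ha⟩, -⟩ := hx y
    have hirr := componentRep_isIrreducible h E (x q)
      (exists_basisElt_smul_ne_zero_of_act_eq h E (x q) a ha u hy)
    obtain ⟨i, ⟨e⟩⟩ := (hρ q).2.2 _ _ hirr
    refine ⟨⟨q, i⟩, ⟨LinearEquiv.symm (LinearEquiv.ofBijective
      (inducedHom h E (x q) (ρ q i) e.symm.toIntertwiningMap) ?_)⟩⟩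
    have := Induced.isSimpleModule h (x q) (ρ q i) ((hρ q).1 i)
    -- Both modules are simple, and the map is nonzero on `1 ⊗ v`.
    refine (LinearMap.bijective_or_eq_zero _).resolve_right fun h0 => ?_
    have := ((hρ q).1 i).nontrivial'
    obtain ⟨v, hv⟩ := exists_ne (0 : V q i)
    have h1 := inducedHom_tmul_one h E (x q) (ρ q i) e.symm.toIntertwiningMap v
    rw [h0, LinearMap.zero_apply] at h1
    refine hv (e.symm.toLinearEquiv.map_eq_zero_iff.1 (Subtype.ext h1.symm))

end Complete

end BismashProduct

/-- The finitely many translates of a nonzero vector span an invariant subspace, hence everything.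
-/
theorem Representation.IsIrreducible.finite_module {E Γ V : Type*} [Field E] [Group Γ] [Finite Γ]
    [AddCommGroup V] [Module E V] {ρ : Representation E Γ V} (hρ : ρ.IsIrreducible) :
    Module.Finite E V := by
  have := hρ.nontrivial'
  obtain ⟨v, hv⟩ := exists_ne (0 : V)
  let S : Subrepresentation ρ :=
    { toSubmodule := Submodule.span E (Set.range fun g => ρ g v)
      apply_mem_toSubmodule := fun g w hw => by
        induction hw using Submodule.span_induction with
        | mem w hw =>
          obtain ⟨g', rfl⟩ := hw
          refine Submodule.subset_span ⟨g * g', ?_⟩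
          simp
        | zero => simp
        | add a b _ _ ha hb =>
          rw [map_add]
          exact add_mem ha hb
        | smul r a _ ha =>
          rw [map_smul]
          exact Submodule.smul_mem _ r ha }
  have hS : S = ⊤ := by
    refine (hρ.eq_bot_or_eq_top S).resolve_left fun h0 => hv ?_
    have h1 : v ∈ S := Submodule.subset_span ⟨1, by simp⟩
    rw [h0] at h1
    exact (Submodule.mem_bot E).1 h1
  rw [Module.finite_def]
  have h2 : Submodule.span E (Set.range fun g => ρ g v) = ⊤ :=
    congrArg Subrepresentation.toSubmodule hS
  rw [← h2]
  exact Submodule.fg_span (Set.finite_range _)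

namespace BismashProduct

open scoped Classical

/-! ### Characters of induced modules and the operation `hatBrauer` -/

section HatCharacters

variable {Q : Type w} [Group Q] {F G : Subgroup Q} {h : F.IsComplement' G}

theorem Induced.finite [Finite F] {E : Type u} [Field E] (x : G) {V : Type u} [AddCommGroup V]
    [Module E V] [Module.Finite E V] (ρ : Representation E (stab h x) V) :
    Module.Finite E (Induced h x ρ) := by
  have : Module.Finite E (MonoidAlgebra E F) := Module.Finite.of_basis (MonoidAlgebra.basis F E)
  exact inferInstanceAs (Module.Finite E (Representation.IndV (stab h x).subtype ρ))

theorem conj_mem_stab {x y : G} {a t : F} (ha : a ∈ stab h y) (ht : act h y t = x) :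
    t⁻¹ * a * t ∈ stab h x := by
  change act h x _ = x
  have ha' : act h y a = y := ha
  rw [act_mul, act_mul, ← (act_eq_iff h x y t).1 ht, ha', ht]

theorem exists_mem_of_act_eq {x y : G} {b : F} {T : Finset F}
    (hT : Subgroup.IsComplement (T : Set F) (stab h x : Set F)) (hb : act h y b = x) :
    ∃ t ∈ T, act h y t = x := by
  obtain ⟨⟨⟨t, ht⟩, ⟨s, hs⟩⟩, hts, -⟩ := Function.Bijective.existsUnique hT b
  refine ⟨t, ht, ?_⟩
  have h1 : t = b * s⁻¹ := eq_mul_inv_of_mul_eq hts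
  rw [h1, act_mul, hb]
  exact inv_mem hs

theorem eq_of_act_eq {x y : G} {t t' : F} {T : Finset F}
    (hT : Subgroup.IsComplement (T : Set F) (stab h x : Set F)) (ht : t ∈ T) (ht' : t' ∈ T)
    (h1 : act h y t = x) (h2 : act h y t' = x) : t = t' := by
  have hs : t⁻¹ * t' ∈ stab h x := by
    change act h x _ = x
    rw [act_mul, ← (act_eq_iff h x y t).1 h1, h2]
  have := @hT.1 ⟨⟨t, ht⟩, ⟨_, hs⟩⟩ ⟨⟨t', ht'⟩, ⟨1, one_mem _⟩⟩ (by simp)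
  simpa using congrArg (fun z => (z.1 : F)) this

variable {Ω : Type*} [CommRing Ω] {p : ℕ}

/-- The elements of `F` carrying `y` to `x` form one coset of `F_x`, which `T` meets exactly once;
only that term survives. -/
theorem hatBrauer_of_act_eq {x : G} {T : Finset F}
    (hT : Subgroup.IsComplement (T : Set F) (stab h x : Set F)) (φ : PRegular p (stab h x) → Ω)
    (z : BReg h p) {t : F} (ht : t ∈ T) (hzt : act h z.1.1 t = x) :
    hatBrauer T φ z =
      φ ⟨⟨t⁻¹ * z.1.2 * t, conj_mem_stab z.2.1 hzt⟩, coprime_conj z t _⟩ := by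
  rw [hatBrauer, Finset.sum_eq_single_of_mem t ht, dif_pos (conj_mem_stab z.2.1 hzt), if_pos hzt]
  intro t' ht' hne
  split_ifs with h1 h2
  · exact absurd (eq_of_act_eq hT ht' ht h2 hzt) hne
  · rfl
  · rfl

theorem hatBrauer_of_forall_ne {x : G} (T : Finset F) (φ : PRegular p (stab h x) → Ω)
    (z : BReg h p) (hz : ∀ b, act h z.1.1 b ≠ x) : hatBrauer T φ z = 0 := by
  refine Finset.sum_eq_zero fun t _ => ?_
  split_ifs with h1 h2
  · exact absurd h2 (hz t)
  · rfl
  · rfl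

/-- The character of the induced module is given by the formula for `χ̂`. -/
theorem hatChar_eq_hatBrauer [Finite F] {E : Type u} [Field E] {x : G} {T : Finset F}
    (hT : Subgroup.IsComplement (T : Set F) (stab h x : Set F)) {V : Type u} [AddCommGroup V]
    [Module E V] [Module.Finite E V] (ρ : Representation E (stab h x) V) (z : BReg h p) :
    hatChar p x ρ z = hatBrauer T (fun g => ρ.character g.1) z := by
  have := Induced.finite x ρ
  by_cases hz : ∃ b, act h z.1.1 b = x
  · obtain ⟨b, hb⟩ := hz
    obtain ⟨t, ht, hzt⟩ := exists_mem_of_act_eq hT hb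
    rw [hatBrauer_of_act_eq hT _ z ht hzt]
    have h1 : inducedAction h x ρ (basisElt h E z.1.1 z.1.2) =
        Induced.tmul h x ρ t ∘ₗ
          (Induced.proj h x ρ ∘ₗ groupAction h x ρ (t⁻¹ * z.1.2)) := by
      ext m
      exact basisElt_smul_of_act_eq h x ρ z.1.1 z.1.2 t hzt m
    -- Cyclicity of the trace moves the computation from `V̂` to `V`, where the composite is `ρ (t⁻¹
    -- a t)`.
    rw [hatChar, h1, LinearMap.trace_comp_comm']
    change _ = LinearMap.trace E V _
    congr 1
    ext v
    simp only [LinearMap.comp_apply, groupAction_tmul]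
    exact Induced.proj_tmul h x ρ _ v _
  · push Not at hz
    rw [hatBrauer_of_forall_ne _ _ _ hz, hatChar]
    have h1 : inducedAction h x ρ (basisElt h E z.1.1 z.1.2) = 0 := by
      ext m
      exact basisElt_smul_of_forall_ne h x ρ z.1.1 z.1.2 hz m
    rw [h1, map_zero]

/-- Take `z = p_x # t g t⁻¹`, with `t` the representative in `T` of the trivial coset (not
necessarily `1`). One `z` serves all `φ`, so `φ ↦ φ̂` is injective and relations can be pulled back.
-/
theorem exists_forall_hatBrauer_eq {x : G} {T : Finset F}
    (hT : Subgroup.IsComplement (T : Set F) (stab h x : Set F)) (g : PRegular p (stab h x)) :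
    ∃ z : BReg h p, z.1.1 = x ∧ ∀ φ : PRegular p (stab h x) → Ω, hatBrauer T φ z = φ g := by
  obtain ⟨t, ht, hxt⟩ := exists_mem_of_act_eq hT (act_one h x)
  have hord : orderOf (t * (g.1 : F) * t⁻¹) = orderOf g.1 :=
    (orderOf_injective (MulAut.conj t).toMonoidHom (MulAut.conj t).injective (g.1 : F)).trans
      (Subgroup.orderOf_coe g.1)
  let z : BReg h p := ⟨(x, t * g.1 * t⁻¹),
    mul_mem (mul_mem (show t ∈ stab h x from hxt) g.1.2) (inv_mem (show t ∈ stab h x from hxt)),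
    hord ▸ g.2⟩
  refine ⟨z, rfl, fun φ => ?_⟩
  rw [hatBrauer_of_act_eq hT φ z ht hxt]
  congr 1
  refine Subtype.ext (Subtype.ext ?_)
  simp [z, mul_assoc]

theorem hatBrauer_sum {ι : Type*} (s : Finset ι) {x : G} (T : Finset F) (c : ι → Ω)
    (φ : ι → PRegular p (stab h x) → Ω) (z : BReg h p) :
    hatBrauer T (fun g => ∑ j ∈ s, c j * φ j g) z = ∑ j ∈ s, c j * hatBrauer T (φ j) z := by
  simp only [hatBrauer, Finset.mul_sum]
  rw [Finset.sum_comm]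
  refine Finset.sum_congr rfl fun t _ => ?_
  split_ifs <;> simp

theorem algebraMap_hatBrauer {K : Type*} [CommRing K] [Algebra K Ω] {x : G} (T : Finset F)
    (φ : PRegular p (stab h x) → K) (z : BReg h p) :
    algebraMap K Ω (hatBrauer T φ z) = hatBrauer T (fun g => algebraMap K Ω (φ g)) z := by
  simp only [hatBrauer, map_sum]
  refine Finset.sum_congr rfl fun t _ => ?_
  split_ifs <;> simp

end HatCharacters

/-! ### Transfer of decomposition matrices and the block diagonal form -/

section Decomposition

variable {Q : Type w} [Group Q] [Finite Q] {F G : Subgroup Q} {h : F.IsComplement' G} {p : ℕ}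
  {K : Type u} [Field K] {Ω : Type*} [CommRing Ω] [Algebra K Ω]

theorem isDecompositionMatrix_hat_iff {x : G} {T : Finset F}
    (hT : Subgroup.IsComplement (T : Set F) (stab h x : Set F)) {ι κ : Type*} [Fintype κ]
    {V : ι → Type u} [∀ i, AddCommGroup (V i)] [∀ i, Module K (V i)]
    [∀ i, Module.Finite K (V i)] (ρ : ∀ i, Representation K (stab h x) (V i))
    (φ : κ → PRegular p (stab h x) → Ω) (D : Matrix ι κ ℤ) :
    IsDecompositionMatrix (fun i => hatChar p x (ρ i)) (fun j => hatBrauer T (φ j)) D ↔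
      IsDecompositionMatrix (fun i (g : PRegular p (stab h x)) => (ρ i).character g.1) φ D := by
  simp only [IsDecompositionMatrix, hatChar_eq_hatBrauer hT, algebraMap_hatBrauer, ← hatBrauer_sum]
  constructor
  · intro H i g
    obtain ⟨z, -, hz⟩ := exists_forall_hatBrauer_eq (Ω := Ω) hT g
    have := H i z
    rwa [hz, hz] at this
  · intro H i z
    congr 1
    funext g
    exact H i g

/-- If the functions `φ q j` are linearly independent over `ℤ` and `D q` is a decomposition matrix
for each `q`, then the decomposition matrix of the induced characters is block diagonal. -/
theorem isDecompositionMatrix_sigma_iff {ι : Type*} [Fintype ι] [DecidableEq ι] (x : ι → G)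
    (hx : ∀ y : G, ∃! q, ∃ a : F, act h (x q) a = y) (T : ι → Finset F)
    (hT : ∀ q, Subgroup.IsComplement (T q : Set F) (stab h (x q) : Set F))
    {n d : ι → Type*} [∀ q, Fintype (d q)]
    {V : ∀ q, n q → Type u} [∀ q i, AddCommGroup (V q i)] [∀ q i, Module K (V q i)]
    [∀ q i, Module.Finite K (V q i)] (ρ : ∀ q i, Representation K (stab h (x q)) (V q i))
    (φ : ∀ q, d q → PRegular p (stab h (x q)) → Ω) (D : ∀ q, Matrix (n q) (d q) ℤ)
    (hD : ∀ q, IsDecompositionMatrix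
      (fun i (g : PRegular p (stab h (x q))) => (ρ q i).character g.1) (φ q) (D q))
    (hφ : ∀ q (c : d q → ℤ), (∀ g, ∑ j, (c j : Ω) * φ q j g = 0) → c = 0)
    (D' : Matrix (Σ q, n q) (Σ q, d q) ℤ) :
    IsDecompositionMatrix (fun e : Σ q, n q => hatChar p (x e.1) (ρ e.1 e.2))
      (fun e : Σ q, d q => hatBrauer (T e.1) (φ e.1 e.2)) D' ↔ D' = Matrix.blockDiagonal' D := by
  have hBD : IsDecompositionMatrix (fun e : Σ q, n q => hatChar p (x e.1) (ρ e.1 e.2))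
      (fun e : Σ q, d q => hatBrauer (T e.1) (φ e.1 e.2)) (Matrix.blockDiagonal' D) := by
    rintro ⟨q, i⟩ z
    rw [Fintype.sum_sigma, Finset.sum_eq_single q]
    · simp only [Matrix.blockDiagonal'_apply_eq]
      exact (isDecompositionMatrix_hat_iff (hT q) (ρ q) (φ q) (D q)).2 (hD q) i z
    · intro q' _ hq'
      refine Finset.sum_eq_zero fun j _ => ?_
      rw [Matrix.blockDiagonal'_apply_ne _ _ _ hq'.symm, Int.cast_zero, zero_mul]
    · simp
  refine ⟨fun H => ?_, fun H => H ▸ hBD⟩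
  ext ⟨q, i⟩ ⟨q', j⟩
  have key : (fun j => D' ⟨q, i⟩ ⟨q', j⟩ - Matrix.blockDiagonal' D ⟨q, i⟩ ⟨q', j⟩) = 0 := by
    refine hφ q' _ fun g => ?_
    obtain ⟨z, hzx, hz⟩ := exists_forall_hatBrauer_eq (Ω := Ω) (hT q') g
    have h1 := (H ⟨q, i⟩ z).symm.trans (hBD ⟨q, i⟩ z)
    -- The first entry of `z` is `x q'`, so induced functions from the other orbits vanish at `z`
    -- and only the block `q'` contributes.
    have h2 : ∀ C : Matrix (Σ q, n q) (Σ q, d q) ℤ,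
        ∑ e, (C ⟨q, i⟩ e : Ω) * hatBrauer (T e.1) (φ e.1 e.2) z =
          ∑ j, (C ⟨q, i⟩ ⟨q', j⟩ : Ω) * φ q' j g := by
      intro C
      rw [Fintype.sum_sigma, Finset.sum_eq_single q']
      · exact Finset.sum_congr rfl fun j _ => by rw [hz]
      · intro q'' _ hne
        refine Finset.sum_eq_zero fun j _ => ?_
        rw [hatBrauer_of_forall_ne, mul_zero]
        rintro b hb
        rw [hzx] at hb
        exact hne ((hx (x q'')).unique ⟨1, act_one h _⟩ ⟨b, hb⟩)
      · simp
    rw [h2, h2] at h1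
    simp only [Int.cast_sub, sub_mul, Finset.sum_sub_distrib, h1, sub_self]
  exact sub_eq_zero.1 (congrFun key j)

end Decomposition

end BismashProduct

/-! ### Characteristic polynomials and eigenvalues -/

/-- In a basis adapted to `W` the matrix of `e` is block upper triangular. -/
theorem LinearMap.charpoly_eq_charpoly_restrict_mul_charpoly_mapQ {R V : Type*} [CommRing R]
    [AddCommGroup V] [Module R V] [Module.Finite R V] [Module.Free R V] (W : Submodule R V)
    [Module.Free R W] [Module.Finite R W] [Module.Free R (V ⧸ W)] (e : V →ₗ[R] V)
    (he : W ≤ W.comap e) :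
    e.charpoly = (e.restrict he).charpoly * (W.mapQ W e he).charpoly := by
  let bW := Module.Free.chooseBasis R W
  let bQ := Module.Free.chooseBasis R (V ⧸ W)
  let b := Module.Basis.sumQuot bW bQ
  let A := LinearMap.toMatrix bW bW (e.restrict he)
  let B : Matrix (Module.Free.ChooseBasisIndex R W) (Module.Free.ChooseBasisIndex R (V ⧸ W)) R :=
    Matrix.of fun i l => (b.repr (e (b (Sum.inr l)))) (Sum.inl i)
  let D := LinearMap.toMatrix bQ bQ (W.mapQ W e he)
  suffices LinearMap.toMatrix b b e = Matrix.fromBlocks A B 0 D by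
    rw [← LinearMap.charpoly_toMatrix e b, this, ← LinearMap.charpoly_toMatrix _ bW,
      ← LinearMap.charpoly_toMatrix _ bQ, Matrix.charpoly_fromBlocks_zero₂₁]
  ext u v
  cases u with
  | inl i =>
    cases v with
    | inl k =>
      simp only [b, Module.Basis.sumQuot_inl, Matrix.fromBlocks_apply₁₁, A,
        LinearMap.toMatrix_apply]
      apply Module.Basis.sumQuot_repr_inl_of_mem
    | inr l => simp [b, LinearMap.toMatrix_apply, Matrix.fromBlocks_apply₁₂, B]
  | inr j =>
    cases v with
    | inl k =>
      suffices W.mkQ (e (bW k)) = 0 by simp [LinearMap.toMatrix_apply, b, this]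
      rw [← LinearMap.mem_ker, Submodule.ker_mkQ]
      exact he (Submodule.coe_mem (bW k))
    | inr l =>
      simp only [LinearMap.toMatrix_apply, Module.Basis.sumQuot_repr_inr,
        Matrix.fromBlocks_apply₂₂, b, D]
      rw [← Module.Basis.sumQuot_inr bW bQ l, W.mapQ_apply]
      simp

theorem Matrix.pow_eq_one_of_isRoot_charpoly {K n : Type*} [Field K] [Fintype n] [DecidableEq n]
    {M : Matrix n n K} {N : ℕ} (hM : M ^ N = 1) {ζ : K} (hζ : M.charpoly.IsRoot ζ) :
    ζ ^ N = 1 := by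
  rw [← Matrix.mem_spectrum_iff_isRoot_charpoly] at hζ
  -- For empty matrices the ring is zero and the spectrum is empty, so no root exists.
  have hn : Nontrivial (Matrix n n K) := by
    by_contra hc
    rw [not_nontrivial_iff_subsingleton] at hc
    simp [spectrum.of_subsingleton] at hζ
  have := spectrum.pow_mem_pow M N hζ
  rwa [hM, spectrum.one_eq, Set.mem_singleton_iff] at this

namespace BismashProduct

/-! ### Lifting roots of unity from characteristic `p` -/

section RootLift

variable (R Ω : Type*) {A κ : Type*} [CommRing R] [Field Ω] [IsAlgClosed Ω] [CharZero Ω]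
  [Algebra R Ω] [CommRing A] [Algebra A Ω] [IsIntegralClosure A R Ω] [Field κ] {p : ℕ}
  [Fact p.Prime] [CharP κ p] (f : A →+* κ)

include R Ω in
-- A primitive `N`-th root of unity of `Ω` is integral over `R`, hence lies in `A`. Having the
-- factorization over `A` allows it to be pushed through `f`.
theorem exists_finset_X_pow_sub_one_eq_prod {N : ℕ} (hN : N ≠ 0) :
    ∃ S : Finset A, (∀ ξ, ξ ∈ S ↔ ξ ^ N = 1) ∧
      (Polynomial.X ^ N - 1 : Polynomial A) = ∏ ξ ∈ S, (Polynomial.X - Polynomial.C ξ) := by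
  have hinj := IsIntegralClosure.algebraMap_injective A R Ω
  have : IsDomain A := hinj.isDomain (algebraMap A Ω)
  have : NeZero (N : Ω) := ⟨Nat.cast_ne_zero.2 hN⟩
  obtain ⟨ζ, hζ⟩ := HasEnoughRootsOfUnity.exists_primitiveRoot Ω N
  have hint : IsIntegral R ζ := IsIntegral.of_pow (Nat.pos_of_ne_zero hN) (by
    rw [hζ.pow_eq_one]
    exact isIntegral_one)
  obtain ⟨ξ, rfl⟩ := IsIntegralClosure.isIntegral_iff (A := A).1 hint
  have hξ : IsPrimitiveRoot ξ N := hζ.of_map_of_injective hinj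
  exact ⟨Polynomial.nthRootsFinset N 1,
    fun ξ => Polynomial.mem_nthRootsFinset (Nat.pos_of_ne_zero hN) 1,
    Polynomial.X_pow_sub_one_eq_prod (Nat.pos_of_ne_zero hN) hξ⟩

theorem natCast_ne_zero_of_coprime {N : ℕ} (hN : N.Coprime p) : (N : κ) ≠ 0 := by
  intro h0
  rw [CharP.cast_eq_zero_iff κ p] at h0
  exact (Fact.out : p.Prime).one_lt.ne' (Nat.dvd_one.1 (hN ▸ Nat.dvd_gcd h0 dvd_rfl))

omit [CharP κ p] in
theorem ne_zero_of_coprime {N : ℕ} (hN : N.Coprime p) : N ≠ 0 := by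
  rintro rfl
  exact (Fact.out : p.Prime).one_lt.ne' (by simpa using hN)

include R Ω in
-- For `N` prime to `p`, `X ^ N - 1` is separable over `κ`, so the images under `f` of its roots in
-- `A` remain distinct.
theorem eq_of_map_eq {ξ ξ' : A} {N : ℕ} (hN : N.Coprime p) (h1 : ξ ^ N = 1) (h2 : ξ' ^ N = 1)
    (hf : f ξ = f ξ') : ξ = ξ' := by
  obtain ⟨S, hS, hprod⟩ := exists_finset_X_pow_sub_one_eq_prod R Ω (A := A)
    (ne_zero_of_coprime hN)
  have h3 := congrArg (Polynomial.map f) hprod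
  rw [Polynomial.map_prod] at h3
  simp only [Polynomial.map_sub, Polynomial.map_pow, Polynomial.map_X, Polynomial.map_one,
    Polynomial.map_C] at h3
  have hsep : (∏ ξ ∈ S, (Polynomial.X - Polynomial.C (f ξ))).Separable := by
    rw [← h3, ← Polynomial.C_1]
    exact Polynomial.separable_X_pow_sub_C 1 (natCast_ne_zero_of_coprime hN) one_ne_zero
  exact hsep.inj_of_prod_X_sub_C ((hS ξ).2 h1) ((hS ξ').2 h2) hf

include R Ω in
theorem exists_map_eq_of_pow_eq_one {ζ : κ} {N : ℕ} (hN : N ≠ 0) (hζ : ζ ^ N = 1) :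
    ∃ ξ : A, ξ ^ N = 1 ∧ f ξ = ζ := by
  obtain ⟨S, hS, hprod⟩ := exists_finset_X_pow_sub_one_eq_prod R Ω (A := A) hN
  have h3 := congrArg (fun q => (Polynomial.map f q).eval ζ) hprod
  simp only [Polynomial.map_prod, Polynomial.eval_prod, Polynomial.map_sub, Polynomial.map_pow,
    Polynomial.map_X, Polynomial.map_one, Polynomial.map_C, Polynomial.eval_sub,
    Polynomial.eval_pow, Polynomial.eval_X, Polynomial.eval_one, Polynomial.eval_C, hζ,
    sub_self] at h3
  obtain ⟨ξ, hξ, h4⟩ := Finset.prod_eq_zero_iff.1 h3.symm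
  exact ⟨ξ, (hS ξ).1 hξ, (sub_eq_zero.1 h4).symm⟩

include R in
-- The choice made in `rootLift` is harmless: two candidates share an exponent prime to `p`, the
-- product of their exponents.
theorem rootLift_map {ξ : A} {N : ℕ} (hN : N.Coprime p) (hξ : ξ ^ N = 1) :
    rootLift p f Ω (f ξ) = algebraMap A Ω ξ := by
  have hex : ∃ ξ' : A, (∃ n : ℕ, n.Coprime p ∧ ξ' ^ n = 1) ∧ f ξ' = f ξ := ⟨ξ, ⟨N, hN, hξ⟩, rfl⟩
  rw [rootLift, dif_pos hex]
  congr 1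
  obtain ⟨⟨n, hn, h1⟩, h2⟩ := hex.choose_spec
  refine eq_of_map_eq R Ω f (Nat.Coprime.mul_left hn hN) ?_ ?_ h2
  · rw [pow_mul, h1, one_pow]
  · rw [mul_comm, pow_mul, hξ, one_pow]

include R in
theorem exists_lift_multiset (s : Multiset κ) {N : ℕ} (hN : N.Coprime p)
    (hs : ∀ ζ ∈ s, ζ ^ N = 1) :
    ∃ b : A, algebraMap A Ω b = (s.map (rootLift p f Ω)).sum ∧ f b = s.sum := by
  induction s using Multiset.induction_on with
  | empty => exact ⟨0, by simp, by simp⟩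
  | cons ζ s ih =>
    obtain ⟨b, hb, hb'⟩ := ih fun ζ hζ => hs ζ (Multiset.mem_cons_of_mem hζ)
    obtain ⟨ξ, hξ, rfl⟩ := exists_map_eq_of_pow_eq_one R Ω f (ne_zero_of_coprime hN)
      (hs ζ (Multiset.mem_cons_self _ _))
    refine ⟨ξ + b, ?_, ?_⟩
    · rw [Multiset.map_cons, Multiset.sum_cons, rootLift_map R Ω f hN hξ, map_add, hb]
    · rw [Multiset.sum_cons, map_add, hb']

end RootLift

/-! ### Integrality and additivity of Brauer characters -/

section Brauer

variable (R : Type*) {Ω A κ k : Type*} [CommRing R] [Field Ω] [IsAlgClosed Ω] [CharZero Ω]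
  [Algebra R Ω] [CommRing A] [Algebra A Ω] [IsIntegralClosure A R Ω] [Field κ] [IsAlgClosed κ]
  {p : ℕ} [Fact p.Prime] [CharP κ p] (f : A →+* κ) [Field k] [Algebra k κ]
  {Γ : Type*} [Group Γ] {W : Type*} [AddCommGroup W] [Module k W] [FiniteDimensional k W]
  (σ : Representation k Γ W)

include R in
/-- The values of a Brauer character are integral, and reduce to the values of the trace. -/
theorem exists_algebraMap_eq_brauerChar (g : PRegular p Γ) :
    ∃ b : A, algebraMap A Ω b = brauerChar p f Ω σ g ∧
      f b = algebraMap k κ (LinearMap.trace k W (σ g.1)) := by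
  let B := Module.Free.chooseBasis k W
  let M := LinearMap.toMatrix B B (σ g.1)
  have hM : (σ g.1).charpoly.aroots κ = (M.map (algebraMap k κ)).charpoly.roots := by
    rw [Matrix.charpoly_map, LinearMap.charpoly_toMatrix]
  have hpow : (M.map (algebraMap k κ)) ^ orderOf g.1 = 1 := by
    have h1 : M ^ orderOf g.1 = 1 := by
      change LinearMap.toMatrix B B (σ g.1) ^ orderOf g.1 = 1
      rw [LinearMap.toMatrix_pow, ← map_pow, pow_orderOf_eq_one, map_one, LinearMap.toMatrix_one]
    rw [← Matrix.map_pow, h1, Matrix.map_one _ (map_zero _) (map_one _)]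
  obtain ⟨b, hb, hb'⟩ := exists_lift_multiset R Ω f
    ((σ g.1).charpoly.aroots κ) g.2 fun ζ hζ => by
      rw [hM] at hζ
      exact Matrix.pow_eq_one_of_isRoot_charpoly hpow (Polynomial.isRoot_of_mem_roots hζ)
  refine ⟨b, hb, ?_⟩
  rw [hb', hM, ← Matrix.trace_eq_sum_roots_charpoly, LinearMap.trace_eq_matrix_trace k B]
  exact (AddMonoidHom.map_trace (algebraMap k κ).toAddMonoidHom M).symm

omit [IsAlgClosed κ] [CharP κ p] [Fact p.Prime] [IsAlgClosed Ω] [CharZero Ω] in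
theorem brauerChar_eq_of_equiv {W' : Type*} [AddCommGroup W'] [Module k W']
    [FiniteDimensional k W'] {σ' : Representation k Γ W'} (e : σ.Equiv σ') :
    brauerChar p f Ω σ = brauerChar p f Ω σ' := by
  funext g
  rw [brauerChar, brauerChar, ← LinearEquiv.charpoly_conj e.toLinearEquiv (σ g.1)]
  congr 4
  exact Representation.Equiv.conj_apply_self g.1 e

/-- The quotient representation by a subrepresentation. -/
noncomputable def quotientRep (S : Subrepresentation σ) : Representation k Γ (W ⧸ S.toSubmodule) where
  toFun g := S.toSubmodule.mapQ S.toSubmodule (σ g) fun _ hv => S.apply_mem_toSubmodule g hv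
  map_one' := by ext; simp
  map_mul' a b := by ext; simp

omit [IsAlgClosed κ] [CharP κ p] [Fact p.Prime] [IsAlgClosed Ω] [CharZero Ω] in
theorem brauerChar_eq_add (S : Subrepresentation σ) (g : PRegular p Γ) :
    brauerChar p f Ω σ g =
      brauerChar p f Ω S.toRepresentation g + brauerChar p f Ω (quotientRep σ S) g := by
  rw [brauerChar, brauerChar, brauerChar, ← Multiset.sum_add, ← Multiset.map_add,
    ← Polynomial.aroots_mul]
  · rw [LinearMap.charpoly_eq_charpoly_restrict_mul_charpoly_mapQ S.toSubmodule (σ g.1)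
      (S.apply_mem_toSubmodule g.1)]
    rfl
  · exact mul_ne_zero (LinearMap.charpoly_monic _).ne_zero (LinearMap.charpoly_monic _).ne_zero

end Brauer

end BismashProduct

namespace BismashProduct

/-! ### Decomposition into irreducible Brauer characters -/

section CompositionFactors

variable {Ω A κ k : Type*} [Field Ω] [CommRing A] [Algebra A Ω] [Field κ]
  (p : ℕ) (f : A →+* κ)

theorem brauerChar_eq_zero_of_finrank_eq_zero [Field k] [Algebra k κ] {Γ W : Type*} [Group Γ]
    [AddCommGroup W] [Module k W] [FiniteDimensional k W] (σ : Representation k Γ W)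
    (hW : Module.finrank k W = 0) (g : PRegular p Γ) : brauerChar p f Ω σ g = 0 := by
  have h1 : (σ g.1).charpoly = 1 := by
    rw [← (LinearMap.charpoly_monic (σ g.1)).natDegree_eq_zero, LinearMap.charpoly_natDegree, hW]
  rw [brauerChar, h1, Polynomial.aroots_one, Multiset.map_zero, Multiset.sum_zero]

/-- Every Brauer character is a sum of irreducible Brauer characters. -/
theorem exists_brauerChar_eq_sum {k : Type u} [Field k] [Algebra k κ] {Γ : Type w} [Group Γ]
    {ι : Type*} [Fintype ι] {W : ι → Type u} [∀ j, AddCommGroup (W j)] [∀ j, Module k (W j)]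
    [∀ j, FiniteDimensional k (W j)] {σ : ∀ j, Representation k Γ (W j)}
    (hσ : IsCompleteIrreps σ) {U : Type u} [AddCommGroup U] [Module k U] [FiniteDimensional k U]
    (τ : Representation k Γ U) :
    ∃ c : ι → ℤ, ∀ g, brauerChar p f Ω τ g = ∑ j, (c j : Ω) * brauerChar p f Ω (σ j) g := by
  classical
  induction hn : Module.finrank k U using Nat.strong_induction_on generalizing U with
  | _ n ih =>
  subst hn
  rcases Nat.eq_zero_or_pos (Module.finrank k U) with h0 | hpos
  · exact ⟨0, fun g => by simp [brauerChar_eq_zero_of_finrank_eq_zero p f τ h0 g]⟩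
  by_cases hirr : τ.IsIrreducible
  · obtain ⟨i, ⟨e⟩⟩ := hσ.2.2 U τ hirr
    refine ⟨Pi.single i 1, fun g => ?_⟩
    rw [brauerChar_eq_of_equiv f τ e, Finset.sum_eq_single i]
    · simp
    · intro j _ hj
      simp [hj]
    · simp
  -- In the reducible case both `S` and `U / S` have smaller dimension, and Brauer characters add.
  · have hS : ∃ S : Subrepresentation τ, S ≠ ⊥ ∧ S ≠ ⊤ := by
      by_contra! hc
      have hnt : Nontrivial U := Module.finrank_pos_iff.1 hpos
      obtain ⟨v, hv⟩ := exists_ne (0 : U)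
      refine hirr { exists_pair_ne := ⟨⊥, ⊤, fun h0 => hv ?_⟩, eq_bot_or_eq_top := fun S => ?_ }
      · have h1 : v ∈ (⊤ : Subrepresentation τ) := Submodule.mem_top (R := k)
        rw [← h0] at h1
        exact (Submodule.mem_bot k).1 h1
      · by_cases hS : S = ⊥
        · exact Or.inl hS
        · exact Or.inr (hc S hS)
    obtain ⟨S, hbot, htop⟩ := hS
    have hbot' : S.toSubmodule ≠ ⊥ := fun h0 =>
      hbot (Subrepresentation.toSubmodule_injective h0)
    have htop' : S.toSubmodule ≠ ⊤ := fun h0 =>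
      htop (Subrepresentation.toSubmodule_injective h0)
    obtain ⟨c, hc⟩ := ih _ (Submodule.finrank_lt htop') S.toRepresentation rfl
    have hlt : Module.finrank k (U ⧸ S.toSubmodule) < Module.finrank k U := by
      have h1 := S.toSubmodule.finrank_quotient_add_finrank
      have h2 := Submodule.one_le_finrank_iff.2 hbot'
      lia
    obtain ⟨c', hc'⟩ := ih _ hlt (quotientRep τ S) rfl
    refine ⟨c + c', fun g => ?_⟩
    rw [brauerChar_eq_add f τ S g, hc, hc', ← Finset.sum_add_distrib]
    exact Finset.sum_congr rfl fun j _ => by simp [add_mul]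

end CompositionFactors

/-! ### Stable lattices -/

section Lattice

/-- A representation of a finite group over the field of fractions of a principal ideal domain is
defined by matrices over that domain. -/
theorem exists_integral_matrices (R : Type*) {K : Type*} [CommRing R] [IsDomain R]
    [IsPrincipalIdealRing R] [Field K] [Algebra R K] [IsFractionRing R K] {Γ V : Type*} [Group Γ]
    [Finite Γ] [AddCommGroup V] [Module K V] [Module.Finite K V] (ρ : Representation K Γ V) :
    ∃ (n : ℕ) (M : Γ →* Matrix (Fin n) (Fin n) R),
      ∀ g, ∃ b : Module.Basis (Fin n) K V,
        LinearMap.toMatrix b b (ρ g) = (M g).map (algebraMap R K) := by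
  let _ : Module R V := Module.compHom V (algebraMap R K)
  have : IsScalarTower R K V := IsScalarTower.of_algebraMap_smul fun r m => rfl
  have : Module.IsTorsionFree R K := inferInstance
  let b := Module.finBasis K V
  -- The `R`-span of all translates of a `K`-basis is a `Γ`-stable lattice, and is free because `R`
  -- is a principal ideal domain.
  let L : Submodule R V :=
    Submodule.span R (Set.range fun z : Γ × Fin (Module.finrank K V) => ρ z.1 (b z.2))
  have hL : L.IsLattice K :=
    { fg := Submodule.fg_span (Set.finite_range _)
      span_eq_top := by
        rw [eq_top_iff, ← b.span_eq]
        refine Submodule.span_mono ?_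
        rintro _ ⟨i, rfl⟩
        exact Submodule.subset_span ⟨(1, i), by simp⟩ }
  have hmem : ∀ g : Γ, ∀ v ∈ L, (ρ g).restrictScalars R v ∈ L := by
    intro g v hv
    induction hv using Submodule.span_induction with
    | mem w hw =>
      obtain ⟨⟨g', i⟩, rfl⟩ := hw
      refine Submodule.subset_span ⟨(g * g', i), ?_⟩
      simp
    | zero => simp
    | add a b _ _ ha hb =>
      rw [map_add]
      exact add_mem ha hb
    | smul r a _ ha =>
      rw [map_smul]
      exact Submodule.smul_mem _ r ha
  let ρL : Γ →* Module.End R L :=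
    { toFun := fun g => ((ρ g).restrictScalars R).restrict (hmem g)
      map_one' := by
        ext v
        simp
      map_mul' := fun g g' => by
        ext v
        simp }
  have : Module.Free R L := Submodule.IsLattice.free K L
  let bL := Module.finBasis R L
  refine ⟨_, (LinearMap.toMatrixAlgEquiv bL).toRingEquiv.toMonoidHom.comp ρL, fun g =>
    ⟨bL.extendOfIsLattice K, ?_⟩⟩
  rw [← LinearEquiv.eq_symm_apply, LinearMap.toMatrix_symm]
  refine (bL.extendOfIsLattice K).ext fun j => ?_
  rw [Matrix.toLin_self]
  simp only [Module.Basis.extendOfIsLattice_apply]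
  have h1 : ρ g (bL j : V) = (ρL g (bL j) : V) := rfl
  rw [h1, ← bL.sum_repr (ρL g (bL j)), Submodule.coe_sum]
  refine Finset.sum_congr rfl fun i _ => ?_
  rw [Submodule.coe_smul, ← algebraMap_smul K]
  simp [LinearMap.toMatrixAlgEquiv_apply]

end Lattice

/-! ### Reduction modulo the maximal ideal -/

section Reduction

variable {R K Ω A κ : Type*} [CommRing R] [IsLocalRing R] [Field K] [Algebra R K] [Field Ω]
  [IsAlgClosed Ω] [CharZero Ω] [Algebra R Ω] [Algebra K Ω] [IsScalarTower R K Ω] [CommRing A]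
  [Algebra R A] [Algebra A Ω] [IsScalarTower R A Ω] [IsIntegralClosure A R Ω] [Field κ]
  [Algebra (IsLocalRing.ResidueField R) κ] {p : ℕ} [Fact p.Prime] [CharP κ p] (f : A →+* κ)

/-- The reduction modulo the maximal ideal of a representation by matrices over a local ring. -/
noncomputable def reduction {Γ : Type*} [Group Γ] {n : ℕ} (M : Γ →* Matrix (Fin n) (Fin n) R) :
    Representation (IsLocalRing.ResidueField R) Γ (Fin n → IsLocalRing.ResidueField R) :=
  (Matrix.toLinAlgEquiv' (R := IsLocalRing.ResidueField R) (n := Fin n)).toRingEquiv.toMonoidHom.comp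
    (((IsLocalRing.residue R).mapMatrix : Matrix (Fin n) (Fin n) R →+* _).toMonoidHom.comp M)

theorem charpoly_reduction {Γ : Type*} [Group Γ] {n : ℕ} (M : Γ →* Matrix (Fin n) (Fin n) R)
    (g : Γ) : (reduction M g).charpoly = (M g).charpoly.map (IsLocalRing.residue R) := by
  rw [← Matrix.charpoly_map]
  exact Matrix.charpoly_toLin' _

/-- The Brauer character of a reduction is the restriction of the ordinary character. -/
theorem brauerChar_reduction
    (hf : ∀ r : R, f (algebraMap R A r) = algebraMap _ κ (IsLocalRing.residue R r))
    {Γ V : Type*} [Group Γ] [AddCommGroup V] [Module K V] [Module.Finite K V]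
    (ρ : Representation K Γ V) {n : ℕ} (M : Γ →* Matrix (Fin n) (Fin n) R) (g : PRegular p Γ)
    (b : Module.Basis (Fin n) K V)
    (hb : LinearMap.toMatrix b b (ρ g.1) = (M g.1).map (algebraMap R K)) :
    brauerChar p f Ω (reduction M) g = algebraMap K Ω (ρ.character g.1) := by
  have hinj := IsIntegralClosure.algebraMap_injective A R Ω
  let N := (M g.1).map (algebraMap R Ω)
  have hN : N ^ orderOf g.1 = 1 := by
    have h1 : M g.1 ^ orderOf g.1 = 1 := by rw [← map_pow, pow_orderOf_eq_one, map_one]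
    rw [← Matrix.map_pow, h1, Matrix.map_one _ (map_zero _) (map_one _)]
  have hroot : ∀ l ∈ N.charpoly.roots, l ^ orderOf g.1 = 1 := fun l hl =>
    Matrix.pow_eq_one_of_isRoot_charpoly hN (Polynomial.isRoot_of_mem_roots hl)
  -- The eigenvalues in `Ω` are roots of unity, hence integral over `R`, and form a multiset in `A`.
  have hs : ∃ s : Multiset A, s.map (algebraMap A Ω) = N.charpoly.roots := by
    have : CanLift Ω A (algebraMap A Ω) (fun l => l ^ orderOf g.1 = 1) := ⟨fun l hl => by
      have hint : IsIntegral R l := IsIntegral.of_pow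
        (Nat.pos_of_ne_zero (ne_zero_of_coprime g.2)) (by rw [hl]; exact isIntegral_one)
      exact IsIntegralClosure.isIntegral_iff (A := A).1 hint⟩
    exact CanLift.prf (self := Multiset.canLift (algebraMap A Ω) _) N.charpoly.roots hroot
  obtain ⟨s, hs⟩ := hs
  have hs1 : ∀ ξ ∈ s, ξ ^ orderOf g.1 = 1 := fun ξ hξ => by
    apply hinj
    rw [map_pow, map_one]
    exact hroot _ (hs ▸ Multiset.mem_map_of_mem _ hξ)
  have hP : (M g.1).charpoly.map (algebraMap R A) =
      (s.map fun ξ => Polynomial.X - Polynomial.C ξ).prod := by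
    apply Polynomial.map_injective _ hinj
    rw [Polynomial.map_map, ← IsScalarTower.algebraMap_eq, ← Matrix.charpoly_map,
      Polynomial.map_multiset_prod, Multiset.map_map]
    have h2 := (IsAlgClosed.splits N.charpoly).eq_prod_roots_of_monic (Matrix.charpoly_monic N)
    rw [← hs, Multiset.map_map] at h2
    refine h2.trans ?_
    simp
  -- The factorization over `A` maps under `f` to one over `κ`; by `hf` it is that of the reduced
  -- characteristic polynomial.
  have hroots : ((reduction M g.1).charpoly).aroots κ = s.map f := by
    have h3 : (M g.1).charpoly.map ((algebraMap (IsLocalRing.ResidueField R) κ).comp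
        (IsLocalRing.residue R)) = ((M g.1).charpoly.map (algebraMap R A)).map f := by
      rw [Polynomial.map_map]
      congr 1
      ext r
      exact (hf r).symm
    rw [Polynomial.aroots, charpoly_reduction, Polynomial.map_map, h3, hP,
      Polynomial.map_multiset_prod, Multiset.map_map]
    have h4 : (Polynomial.map f ∘ fun ξ : A => Polynomial.X - Polynomial.C ξ) =
        (fun ζ => Polynomial.X - Polynomial.C ζ) ∘ f := by
      funext ξ
      simp
    rw [h4, ← Multiset.map_map, Polynomial.roots_multiset_prod_X_sub_C]
  have h5 : s.map (rootLift p f Ω ∘ f) = s.map (algebraMap A Ω) :=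
    Multiset.map_congr rfl fun ξ hξ => rootLift_map R Ω f g.2 (hs1 ξ hξ)
  rw [brauerChar, hroots, Multiset.map_map, h5, hs,
    ← Matrix.trace_eq_sum_roots_charpoly, Representation.character,
    LinearMap.trace_eq_matrix_trace K b, hb]
  refine Eq.trans ?_ (AddMonoidHom.map_trace (algebraMap K Ω).toAddMonoidHom _).symm
  congr 1
  ext i j
  exact IsScalarTower.algebraMap_apply R K Ω _

end Reduction

section Existence

/-- The ordinary characters of a finite group have a decomposition matrix with respect to the
irreducible Brauer characters. -/
theorem exists_isDecompositionMatrix {R : Type u} {K : Type*} {Ω A κ : Type*} [CommRing R]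
    [IsDomain R] [IsPrincipalIdealRing R] [IsLocalRing R] [Field K] [Algebra R K]
    [IsFractionRing R K] [Field Ω]
    [IsAlgClosed Ω] [CharZero Ω] [Algebra R Ω] [Algebra K Ω] [IsScalarTower R K Ω] [CommRing A]
    [Algebra R A] [Algebra A Ω] [IsScalarTower R A Ω] [IsIntegralClosure A R Ω] [Field κ]
    [Algebra (IsLocalRing.ResidueField R) κ] {p : ℕ} [Fact p.Prime] [CharP κ p] (f : A →+* κ)
    (hf : ∀ r : R, f (algebraMap R A r) = algebraMap _ κ (IsLocalRing.residue R r))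
    {Γ : Type w} [Group Γ] [Finite Γ] {ι J : Type*} [Fintype J] {V : ι → Type*}
    [∀ i, AddCommGroup (V i)] [∀ i, Module K (V i)] [∀ i, Module.Finite K (V i)]
    (ρ : ∀ i, Representation K Γ (V i))
    {W : J → Type u} [∀ j, AddCommGroup (W j)] [∀ j, Module (IsLocalRing.ResidueField R) (W j)]
    [∀ j, FiniteDimensional (IsLocalRing.ResidueField R) (W j)]
    {σ : ∀ j, Representation (IsLocalRing.ResidueField R) Γ (W j)} (hσ : IsCompleteIrreps σ) :
    ∃ D : Matrix ι J ℤ, IsDecompositionMatrix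
      (fun i (g : PRegular p Γ) => (ρ i).character g.1) (fun j => brauerChar p f Ω (σ j)) D := by
  choose n M hM using fun i => exists_integral_matrices R (ρ i)
  choose c hc using fun i =>
    exists_brauerChar_eq_sum (Ω := Ω) p f hσ (reduction (M i))
  refine ⟨c, fun i g => ?_⟩
  obtain ⟨b, hb⟩ := hM i g.1
  rw [← brauerChar_reduction f hf (ρ i) (M i) g b hb]
  exact hc i g

end Existence

end BismashProduct

namespace BismashProduct

/-! ### Linear independence of traces over a finite field -/

section Trace

variable {k : Type*} [Field k] [Finite k]

/-- By Wedderburn `D` is a finite field, and the trace of a finite field extension of `k` is nonzero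
by separability. -/
theorem exists_trace_mulRight_ne_zero (k D : Type*) [Field k] [Finite k] [DivisionRing D]
    [Algebra k D] [Module.Finite k D] :
    ∃ c : D, LinearMap.trace k D (LinearMap.mulRight k c) ≠ 0 := by
  have : Finite D := Module.finite_of_finite k
  let _ : Field D := littleWedderburn D
  by_contra! hc
  refine Algebra.trace_ne_zero k D (LinearMap.ext fun c => ?_)
  rw [LinearMap.zero_apply, ← hc c, Algebra.trace_apply]
  congr 1
  ext d
  exact mul_comm _ _

/-- View `M` as a vector space over the division ring `D = End_A(M)`. With `l` a `D`-linear
retraction of `d ↦ d w`, the map `m ↦ (l m)(c w)` is `D`-linear of rank at most one, and its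
`k`-trace is that of right multiplication by `c` on `D`. -/
theorem exists_end_trace_ne_zero {A M : Type*} [Ring A] [Algebra k A] [AddCommGroup M]
    [Module k M] [Module A M] [IsScalarTower k A M] [IsSimpleModule A M] [Module.Finite k M] :
    ∃ e : M →ₗ[k] M, LinearMap.trace k M e ≠ 0 ∧
      ∀ (d : Module.End A M) (m : M), e (d m) = d (e m) := by
  classical
  have : Nontrivial M := IsSimpleModule.nontrivial A M
  obtain ⟨w, hw⟩ := exists_ne (0 : M)
  have : Module.Finite k (Module.End A M) :=
    Module.Finite.of_injective
      ({ toFun := fun d => d.restrictScalars k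
         map_add' := fun _ _ => rfl
         map_smul' := fun _ _ => rfl } : Module.End A M →ₗ[k] Module.End k M)
      fun a b hab => LinearMap.ext fun m => LinearMap.congr_fun hab m
  obtain ⟨c, hc⟩ := exists_trace_mulRight_ne_zero k (Module.End A M)
  obtain ⟨l, hl⟩ := LinearMap.exists_leftInverse_of_injective
    (LinearMap.toSpanSingleton (Module.End A M) M w)
    (LinearMap.ker_toSpanSingleton (Module.End A M) hw)
  have hlw : ∀ d : Module.End A M, l (d w) = d := fun d => by
    have := LinearMap.congr_fun hl d
    simpa using this
  let t : Module.End A M →ₗ[k] M :=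
    { toFun := fun d => d (c w)
      map_add' := fun _ _ => rfl
      map_smul' := fun _ _ => rfl }
  let l' : M →ₗ[k] Module.End A M :=
    { toFun := l
      map_add' := map_add l
      map_smul' := fun r m => by
        have h1 : r • m = (r • (1 : Module.End A M)) m := rfl
        rw [h1, ← Module.End.smul_def, map_smul, smul_eq_mul, smul_mul_assoc, one_mul]
        rfl }
  refine ⟨t ∘ₗ l', ?_, fun d m => ?_⟩
  · rw [LinearMap.trace_comp_comm']
    have : l' ∘ₗ t = LinearMap.mulRight k c := by
      refine LinearMap.ext fun d => ?_
      change l (d (c w)) = d * c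
      exact hlw (d * c)
    rwa [this]
  · change l (d m) (c w) = d (l m (c w))
    have h1 : l (d m) = d * l m := l.map_smul d m
    rw [h1]
    rfl

/-- For pairwise nonisomorphic simple modules, some element of the algebra has nonzero trace on a
given one of them and acts as zero on the others. -/
theorem exists_trace_lsmul_ne_zero {A J : Type*} [Ring A] [Algebra k A] [Finite J] {M : J → Type*}
    [∀ j, AddCommGroup (M j)] [∀ j, Module k (M j)] [∀ j, Module A (M j)]
    [∀ j, IsScalarTower k A (M j)] [∀ j, IsSimpleModule A (M j)] [∀ j, Module.Finite k (M j)]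
    (hM : ∀ i j, Nonempty (M i ≃ₗ[A] M j) → i = j) (j : J) :
    ∃ α : A, LinearMap.trace k (M j) (Algebra.lsmul k k (M j) α) ≠ 0 ∧
      ∀ i ≠ j, Algebra.lsmul k k (M i) α = 0 := by
  classical
  have := Fintype.ofFinite J
  obtain ⟨e, he, hcomm⟩ := exists_end_trace_ne_zero (k := k) (A := A) (M := M j)
  have hzero : ∀ i i', i ≠ i' → ∀ φ : M i →ₗ[A] M i', φ = 0 := fun i i' hne φ =>
    (LinearMap.bijective_or_eq_zero φ).resolve_left fun hb =>
      hne (hM i i' ⟨LinearEquiv.ofBijective φ hb⟩)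
  have hsingle : ∀ (φ : Module.End A (∀ i, M i)) (w : M j),
      φ (Pi.single j w) = Pi.single j (φ (Pi.single j w) j) := by
    intro φ w
    funext i
    by_cases hi : i = j
    · subst hi
      simp
    · rw [Pi.single_eq_of_ne hi]
      exact LinearMap.congr_fun
        (hzero j i (Ne.symm hi) (LinearMap.proj i ∘ₗ φ ∘ₗ LinearMap.single A M j)) w
  have hproj : ∀ (φ : Module.End A (∀ i, M i)) (m : ∀ i, M i),
      φ m j = φ (Pi.single j (m j)) j := by
    intro φ m
    conv_lhs => rw [← Finset.univ_sum_single m, map_sum, Finset.sum_apply]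
    refine Finset.sum_eq_single j (fun i _ hi => ?_) (by simp)
    exact LinearMap.congr_fun
      (hzero i j hi (LinearMap.proj j ∘ₗ φ ∘ₗ LinearMap.single A M i)) (m i)
  -- Project to the factor `j`, then apply `e`. This commutes with all `A`-endomorphisms of the
  -- product, since there are no nonzero maps between distinct factors.
  let f : Module.End (Module.End A (∀ i, M i)) (∀ i, M i) :=
    { toFun := fun m => Pi.single j (e (m j))
      map_add' := fun m m' => by rw [Pi.add_apply, map_add, Pi.single_add]
      map_smul' := fun φ m => by
        change Pi.single j (e (φ m j)) = φ (Pi.single j (e (m j)))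
        rw [hsingle φ (e (m j)), hproj φ m]
        congr 1
        exact hcomm (LinearMap.proj j ∘ₗ φ ∘ₗ LinearMap.single A M j) (m j) }
  have : ∀ i, Finite (M i) := fun i => Module.finite_of_finite k
  have := Fintype.ofFinite (∀ i, M i)
  -- The product is a finite set, so density yields one `α` that agrees with `f` on every vector.
  obtain ⟨α, hα⟩ := jacobson_density f Finset.univ
  refine ⟨α, ?_, fun i hi => ?_⟩
  · have : Algebra.lsmul k k (M j) α = e := by
      refine LinearMap.ext fun w => ?_
      have h1 := congrFun (hα (Pi.single j w) (Finset.mem_univ _)) j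
      change Pi.single j (e ((Pi.single j w : ∀ i, M i) j)) j = (α • (Pi.single j w : ∀ i, M i)) j at h1
      rw [Pi.single_eq_same, Pi.single_eq_same, Pi.smul_apply, Pi.single_eq_same] at h1
      exact h1.symm
    rwa [this]
  · refine LinearMap.ext fun w => ?_
    have h1 := congrFun (hα (Pi.single i w) (Finset.mem_univ _)) i
    change Pi.single j (e ((Pi.single i w : ∀ i, M i) j)) i = (α • (Pi.single i w : ∀ i, M i)) i at h1
    rw [Pi.single_eq_of_ne hi, Pi.smul_apply, Pi.single_eq_same] at h1
    exact h1.symm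

/-- The traces of pairwise nonisomorphic irreducible representations over a finite field are
linearly independent. -/
theorem eq_zero_of_forall_sum_trace_eq_zero {Γ : Type*} [Group Γ] {J : Type*} [Fintype J]
    {W : J → Type*} [∀ j, AddCommGroup (W j)] [∀ j, Module k (W j)] [∀ j, Module.Finite k (W j)]
    (σ : ∀ j, Representation k Γ (W j)) (hirr : ∀ j, (σ j).IsIrreducible)
    (hne : ∀ i j, Nonempty ((σ i).Equiv (σ j)) → i = j) (a : J → k)
    (ha : ∀ g, ∑ j, a j * LinearMap.trace k (W j) (σ j g) = 0) : a = 0 := by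
  have : ∀ j, IsSimpleModule (MonoidAlgebra k Γ) (σ j).asModule := fun j =>
    (Representation.irreducible_iff_isSimpleModule_asModule _).1 (hirr j)
  have : ∀ j, Module.Finite k (σ j).asModule := fun j => inferInstanceAs (Module.Finite k (W j))
  have hall : ∀ α : MonoidAlgebra k Γ,
      ∑ j, a j * LinearMap.trace k (W j) ((σ j).asAlgebraHom α) = 0 := by
    intro α
    induction α using MonoidAlgebra.induction_on with
    | of g =>
      rw [← ha g]
      simp
    | add α β hα hβ => simp only [map_add, mul_add, Finset.sum_add_distrib, hα, hβ, add_zero]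
    | smul r α hα =>
      simp only [map_smul, smul_eq_mul]
      simp only [mul_left_comm _ r, ← Finset.mul_sum, hα, mul_zero]
  funext j
  obtain ⟨α, h1, h2⟩ := exists_trace_lsmul_ne_zero (k := k) (A := MonoidAlgebra k Γ)
    (M := fun j => (σ j).asModule) (fun i j ⟨e⟩ => hne i j ⟨Representation.IntertwiningMap.ofBijective
      ((Representation.IntertwiningMap.equivLinearMapAsModule (σ i) (σ j)).symm e.toLinearMap)
      e.bijective⟩) j
  have h3 : ∀ i, (σ i).asAlgebraHom α = Algebra.lsmul k k (σ i).asModule α := by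
    intro i
    rfl
  have h4 := hall α
  rw [Finset.sum_eq_single j (fun i _ hi => by rw [h3, h2 i hi]; exact mul_eq_zero_of_right _ (map_zero _)) (by simp)] at h4
  exact (mul_eq_zero.1 h4).resolve_right h1

/-- In characteristic `p`, the trace of a group element is the trace of its `p`-regular part. -/
theorem exists_pRegular_trace_eq (p : ℕ) [Fact p.Prime] [CharP k p] {Γ : Type*} [Group Γ]
    [Finite Γ] (g : Γ) :
    ∃ g' : PRegular p Γ, ∀ {W : Type w} [AddCommGroup W] [Module k W] [Module.Finite k W]
      (σ : Representation k Γ W),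
      LinearMap.trace k W (σ g'.1) = LinearMap.trace k W (σ g) := by
  have := Fintype.ofFinite k
  obtain ⟨m, hp, hcard⟩ := FiniteField.card k p
  obtain ⟨a, m', hm', hord⟩ := Nat.exists_eq_pow_mul_and_not_dvd (orderOf_pos g).ne' p hp.ne_one
  -- Here `p ^ a` is the `p`-part of the order of `g` and `card k = p ^ m` with `m > 0`, so raising
  -- to the power `card k ^ a` kills the `p`-part.
  have hpow : (g ^ Fintype.card k ^ a) ^ m' = 1 := by
    rw [← pow_mul, ← orderOf_dvd_iff_pow_eq_one, hord, hcard, ← pow_mul]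
    exact Nat.mul_dvd_mul_right (pow_dvd_pow p (Nat.le_mul_of_pos_left a m.pos)) m'
  refine ⟨⟨g ^ Fintype.card k ^ a, ?_⟩, fun {W} _ _ _ σ => ?_⟩
  · exact Nat.Coprime.coprime_dvd_left (orderOf_dvd_of_pow_eq_one hpow)
      ((Nat.Prime.coprime_iff_not_dvd hp).2 hm').symm
  · let b := Module.Free.chooseBasis k W
    -- With `q = card k`, one has `tr (M ^ q) = (tr M) ^ q = tr M`.
    have key : ∀ (n : ℕ) (x : Γ), LinearMap.trace k W (σ (x ^ Fintype.card k ^ n)) =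
        LinearMap.trace k W (σ x) := by
      intro n x
      induction n generalizing x with
      | zero => simp
      | succ n ih =>
        rw [pow_succ, pow_mul, map_pow, LinearMap.trace_eq_matrix_trace k b,
          ← LinearMap.toMatrix_pow, FiniteField.trace_pow_card, FiniteField.pow_card,
          ← LinearMap.trace_eq_matrix_trace k b, ih]
    exact key a g

end Trace

/-! ### Integral independence of irreducible Brauer characters -/

section Independence

/-- The irreducible Brauer characters are linearly independent over `ℤ`. -/
theorem eq_zero_of_forall_sum_brauerChar_eq_zero (R : Type*) {Ω A κ k : Type*} [CommRing R]
    [Field Ω] [IsAlgClosed Ω] [CharZero Ω] [Algebra R Ω] [CommRing A] [Algebra A Ω]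
    [IsIntegralClosure A R Ω] [Field κ] [IsAlgClosed κ] {p : ℕ} [Fact p.Prime] [CharP κ p]
    (f : A →+* κ) [Field k] [Finite k] [CharP k p] [Algebra k κ] {Γ : Type*} [Group Γ] [Finite Γ]
    {J : Type*} [Fintype J] {W : J → Type*} [∀ j, AddCommGroup (W j)] [∀ j, Module k (W j)]
    [∀ j, FiniteDimensional k (W j)] (σ : ∀ j, Representation k Γ (W j))
    (hirr : ∀ j, (σ j).IsIrreducible)
    (hne : ∀ i j, Nonempty ((σ i).Equiv (σ j)) → i = j) (c : J → ℤ)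
    (hc : ∀ g, ∑ j, (c j : Ω) * brauerChar p f Ω (σ j) g = 0) : c = 0 := by
  -- Under `f` the relation becomes one between traces, so every `c j` vanishes in `k` and is
  -- divisible by `p`; `p` can be cancelled since `Ω` has characteristic zero.
  have hstep : ∀ c : J → ℤ, (∀ g, ∑ j, (c j : Ω) * brauerChar p f Ω (σ j) g = 0) →
      ∃ c' : J → ℤ, c = (p : ℤ) • c' ∧
        ∀ g, ∑ j, (c' j : Ω) * brauerChar p f Ω (σ j) g = 0 := by
    intro c hc
    have h0 : (fun j => (c j : k)) = 0 := by
      refine eq_zero_of_forall_sum_trace_eq_zero σ hirr hne _ fun g => ?_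
      obtain ⟨g', hg'⟩ := exists_pRegular_trace_eq (k := k) p g
      choose b hb hfb using fun j => exists_algebraMap_eq_brauerChar R (Ω := Ω) f (σ j) g'
      have h1 : ∑ j, (c j : A) * b j = 0 := by
        apply IsIntegralClosure.algebraMap_injective A R Ω
        simpa [hb] using hc g'
      apply (algebraMap k κ).injective
      have h2 := congrArg f h1
      have h3 : ∀ j, f (b j) = algebraMap k κ (LinearMap.trace k (W j) (σ j g)) := fun j =>
        (hfb j).trans (congrArg _ (hg' (σ j)))
      simpa [h3] using h2
    have hdvd : ∀ j, ∃ d : ℤ, c j = p * d := fun j =>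
      (CharP.intCast_eq_zero_iff k p (c j)).1 (congrFun h0 j)
    choose c' hc' using hdvd
    refine ⟨c', funext hc', fun g => ?_⟩
    have h3 := hc g
    simp only [hc', Int.cast_mul, Int.cast_natCast, mul_assoc, ← Finset.mul_sum] at h3
    exact (mul_eq_zero.1 h3).resolve_left (Nat.cast_ne_zero.2 (Fact.out : p.Prime).ne_zero)
  have hpow : ∀ (n : ℕ) (c : J → ℤ), (∀ g, ∑ j, (c j : Ω) * brauerChar p f Ω (σ j) g = 0) →
      ∀ j, (p : ℤ) ^ n ∣ c j := by
    intro n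
    induction n with
    | zero => exact fun c _ j => by simp
    | succ n ih =>
      intro c hc j
      obtain ⟨c', rfl, hc'⟩ := hstep c hc
      rw [pow_succ']
      exact mul_dvd_mul_left _ (ih c' hc' j)
  funext j
  -- The exponent `|c j|` suffices because `|c j| < p ^ |c j|`.
  have h1 := hpow (c j).natAbs c hc j
  refine Int.eq_zero_of_abs_lt_dvd h1 ?_
  rw [Int.abs_eq_natAbs]
  exact_mod_cast Nat.lt_pow_self (Fact.out : p.Prime).one_lt

end Independence

end BismashProduct

/-! ### The residue field of the completion -/

section ResidueField

open IsDedekindDomain NumberField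

variable {L : Type*} [Field L] [NumberField L] (v : HeightOneSpectrum (𝓞 L))

theorem IsDedekindDomain.HeightOneSpectrum.residue_eq_zero_of_valued_lt_one
    (r : v.adicCompletionIntegers L) (hr : Valued.v (r : v.adicCompletion L) < 1) :
    IsLocalRing.residue (v.adicCompletionIntegers L) r = 0 := by
  rw [IsLocalRing.residue_eq_zero_iff, IsLocalRing.mem_maximalIdeal, mem_nonunits_iff,
    HeightOneSpectrum.adicCompletionIntegers.isUnit_iff_valued_eq_one]
  exact hr.ne

theorem IsDedekindDomain.HeightOneSpectrum.residue_algebraMap_eq_zero (a : 𝓞 L)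
    (ha : a ∈ v.asIdeal) :
    IsLocalRing.residue (v.adicCompletionIntegers L) (algebraMap (𝓞 L) _ a) = 0 := by
  apply v.residue_eq_zero_of_valued_lt_one
  have h1 : ((algebraMap (𝓞 L) (v.adicCompletionIntegers L) a : v.adicCompletionIntegers L) :
      v.adicCompletion L) = ((algebraMap (𝓞 L) L a : L) : v.adicCompletion L) := rfl
  rw [h1, HeightOneSpectrum.valuedAdicCompletion_eq_valuation',
    HeightOneSpectrum.valuation_lt_one_iff_mem]
  exact ha

/-- Approximate `r` by some `l ∈ L` by density; `l` is then `v`-integral and can itself be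
approximated by an algebraic integer. -/
theorem IsDedekindDomain.HeightOneSpectrum.exists_valued_coe_sub_lt_one
    (r : v.adicCompletionIntegers L) :
    ∃ a : 𝓞 L, Valued.v (((algebraMap (𝓞 L) L a : L) : v.adicCompletion L) - r) < 1 := by
  have hopen : {y : v.adicCompletion L | Valued.v (y - r) < 1} ∈ nhds (r : v.adicCompletion L) := by
    rw [Valued.mem_nhds]
    exact ⟨1, fun y hy => by simpa using hy⟩
  obtain ⟨l, hl⟩ := (HeightOneSpectrum.denseRange_algebraMap (K := L) (v := v)).mem_nhds
    hopen
  have hl' : Valued.v ((l : v.adicCompletion L) - r) < 1 := hl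
  have hl1 : v.valuation L l ≤ 1 := by
    rw [← HeightOneSpectrum.valuedAdicCompletion_eq_valuation']
    have h2 := Valued.v.map_add ((l : v.adicCompletion L) - r) r
    rw [sub_add_cancel] at h2
    exact h2.trans (max_le hl'.le r.2)
  obtain ⟨a, ha⟩ := v.exists_valuation_sub_lt_of_integer hl1 1
  refine ⟨a, ?_⟩
  have h3 : Valued.v ((algebraMap (𝓞 L) L a : L) - (l : v.adicCompletion L)) < 1 := by
    have h4 : ((algebraMap (𝓞 L) L a : L) : v.adicCompletion L) - (l : v.adicCompletion L) =
        ((algebraMap (𝓞 L) L a - l : L) : v.adicCompletion L) :=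
      (map_sub (algebraMap L (v.adicCompletion L)) _ _).symm
    rw [h4, HeightOneSpectrum.valuedAdicCompletion_eq_valuation']
    simpa using ha
  have h5 := Valued.v.map_add ((algebraMap (𝓞 L) L a : L) - (l : v.adicCompletion L))
    ((l : v.adicCompletion L) - r)
  rw [sub_add_sub_cancel] at h5
  exact h5.trans_lt (max_lt h3 hl')

/-- The finite ring `𝓞 L ⧸ v` surjects onto the residue field, by the approximation above. -/
theorem IsDedekindDomain.HeightOneSpectrum.finite_residueField :
    Finite (IsLocalRing.ResidueField (v.adicCompletionIntegers L)) := by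
  let φ : 𝓞 L ⧸ v.asIdeal →+* IsLocalRing.ResidueField (v.adicCompletionIntegers L) :=
    Ideal.Quotient.lift v.asIdeal ((IsLocalRing.residue (v.adicCompletionIntegers L)).comp
      (algebraMap (𝓞 L) _)) fun a ha => v.residue_algebraMap_eq_zero a ha
  have : v.asIdeal.IsMaximal := v.isMaximal
  refine Finite.of_surjective φ fun z => ?_
  obtain ⟨r, rfl⟩ := IsLocalRing.residue_surjective z
  obtain ⟨a, ha⟩ := v.exists_valued_coe_sub_lt_one r
  refine ⟨Ideal.Quotient.mk _ a, ?_⟩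
  rw [Ideal.Quotient.lift_mk, RingHom.comp_apply, ← sub_eq_zero, ← map_sub]
  exact v.residue_eq_zero_of_valued_lt_one _ ha

theorem IsDedekindDomain.HeightOneSpectrum.charP_residueField (p : ℕ) [Fact p.Prime]
    (hp : (p : 𝓞 L) ∈ v.asIdeal) :
    CharP (IsLocalRing.ResidueField (v.adicCompletionIntegers L)) p := by
  have h0 := v.residue_algebraMap_eq_zero _ hp
  rw [map_natCast, map_natCast] at h0
  exact (CharP.ringChar_of_prime_eq_zero (Fact.out : p.Prime) h0) ▸ ringChar.charP _

end ResidueField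

/-! ### The main theorem -/

open BismashProduct IsDedekindDomain NumberField in
theorem mainTheorem7
    -- the factorizable group `Q = F G`
    {Q : Type w} [Group Q] [Finite Q] {F G : Subgroup Q} (h : F.IsComplement' G)
    -- the splitting field `L`, the prime `v` above `p`, and the `p`-modular system `(K, R, k)`:
    -- `K = v.adicCompletion L`, `R = v.adicCompletionIntegers L`, `k` the residue field of `R`
    {L : Type u} [Field L] [NumberField L] (hL : IsSplit L (Bismash h L))
    (p : ℕ) [Fact p.Prime] (v : HeightOneSpectrum (𝓞 L)) (hp : (p : 𝓞 L) ∈ v.asIdeal)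
    -- an extension of the residue map `R → k` to the integral closure of `R`
    (f : integralClosure (v.adicCompletionIntegers L) (AlgebraicClosure (v.adicCompletion L)) →+*
      AlgebraicClosure (IsLocalRing.ResidueField (v.adicCompletionIntegers L)))
    (hf : ∀ r : v.adicCompletionIntegers L, f (algebraMap _ _ r) =
      algebraMap _ _ (IsLocalRing.residue (v.adicCompletionIntegers L) r))
    -- exactly `s` orbits of `F` on `G`, with representatives `x q`
    {s : ℕ} (x : Fin s → G) (hx : ∀ y : G, ∃! q, ∃ a : F, act h (x q) a = y)
    -- representatives of the cosets `t F_{x q}`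
    (T : Fin s → Finset F)
    (hT : ∀ q, Subgroup.IsComplement (T q : Set F) (stab h (x q) : Set F))
    -- the irreducible representations of `K F_{x q}` and of `k F_{x q}`
    {n d : Fin s → ℕ}
    {V : ∀ q, Fin (n q) → Type u} [∀ q i, AddCommGroup (V q i)]
    [∀ q i, Module (v.adicCompletion L) (V q i)]
    (ρ : ∀ q i, Representation (v.adicCompletion L) (stab h (x q)) (V q i))
    (hρ : ∀ q, IsCompleteIrreps (ρ q))
    {W : ∀ q, Fin (d q) → Type u} [∀ q j, AddCommGroup (W q j)]
    [∀ q j, Module (IsLocalRing.ResidueField (v.adicCompletionIntegers L)) (W q j)]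
    [∀ q j, FiniteDimensional (IsLocalRing.ResidueField (v.adicCompletionIntegers L)) (W q j)]
    (σ : ∀ q j, Representation (IsLocalRing.ResidueField (v.adicCompletionIntegers L))
      (stab h (x q)) (W q j))
    (hσ : ∀ q, IsCompleteIrreps (σ q)) :
    -- the induced modules are all the simple modules of `H_K` and of `H_k`
    IsCompleteSimples.{u} (Bismash h (v.adicCompletion L))
      (fun e : Σ q, Fin (n q) => Induced h (x e.1) (ρ e.1 e.2)) ∧
    IsCompleteSimples.{u} (Bismash h (IsLocalRing.ResidueField (v.adicCompletionIntegers L)))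
      (fun e : Σ q, Fin (d q) => Induced h (x e.1) (σ e.1 e.2)) ∧
    ∃ D : ∀ q, Matrix (Fin (n q)) (Fin (d q)) ℤ,
      -- `D q` is the decomposition matrix of the group `F_{x q}`
      (∀ q D', IsDecompositionMatrix
        (fun i (g : PRegular p (stab h (x q))) => (ρ q i).character g.1)
        (fun j => brauerChar p f (AlgebraicClosure (v.adicCompletion L)) (σ q j)) D' ↔
          D' = D q) ∧
      -- `D q` is the decomposition matrix of the induced characters from `F_{x q}`
      (∀ q D', IsDecompositionMatrix
        (fun i => hatChar p (x q) (ρ q i))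
        (fun j => hatBrauer (T q)
          (brauerChar p f (AlgebraicClosure (v.adicCompletion L)) (σ q j))) D' ↔
          D' = D q) ∧
      -- the decomposition matrix of `H` is block diagonal with blocks `D q`
      (∀ D', IsDecompositionMatrix
        (fun e : Σ q, Fin (n q) => hatChar p (x e.1) (ρ e.1 e.2))
        (fun e : Σ q, Fin (d q) => hatBrauer (T e.1)
          (brauerChar p f (AlgebraicClosure (v.adicCompletion L)) (σ e.1 e.2))) D' ↔
          D' = Matrix.blockDiagonal' D) := by
  have hfin := v.finite_residueField
  have hchar := v.charP_residueField p hp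
  have hcharκ : CharP (AlgebraicClosure (IsLocalRing.ResidueField (v.adicCompletionIntegers L))) p :=
    charP_of_injective_algebraMap (algebraMap
      (IsLocalRing.ResidueField (v.adicCompletionIntegers L)) _).injective p
  have hchar0 : CharZero (v.adicCompletion L) :=
    charZero_of_injective_algebraMap (algebraMap L (v.adicCompletion L)).injective
  have hchar0' : CharZero (AlgebraicClosure (v.adicCompletion L)) :=
    charZero_of_injective_algebraMap (algebraMap (v.adicCompletion L) _).injective
  have hV : ∀ q i, Module.Finite (v.adicCompletion L) (V q i) := fun q i =>
    ((hρ q).1 i).finite_module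
  have hind : ∀ q (c : Fin (d q) → ℤ), (∀ g, ∑ j, (c j : AlgebraicClosure (v.adicCompletion L)) *
      brauerChar p f (AlgebraicClosure (v.adicCompletion L)) (σ q j) g = 0) → c = 0 := fun q c hc =>
    eq_zero_of_forall_sum_brauerChar_eq_zero (v.adicCompletionIntegers L) f (σ q) (hσ q).1
      (hσ q).2.1 c hc
  choose D hD using fun q => exists_isDecompositionMatrix
    (Ω := AlgebraicClosure (v.adicCompletion L)) f hf (ρ q) (hσ q)
  have hD' : ∀ q D', IsDecompositionMatrix
      (fun i (g : PRegular p (stab h (x q))) => (ρ q i).character g.1)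
      (fun j => brauerChar p f (AlgebraicClosure (v.adicCompletion L)) (σ q j)) D' ↔
        D' = D q := by
    refine fun q D' => ⟨fun H => ?_, fun H => H ▸ hD q⟩
    ext i j
    -- Two decompositions of the same character differ by an integral relation between irreducible
    -- Brauer characters.
    have h1 : (fun j => D' i j - D q i j) = 0 := hind q _ fun g => by
      have h2 := (H i g).symm.trans (hD q i g)
      simp only [Int.cast_sub, sub_mul, Finset.sum_sub_distrib, h2, sub_self]
    exact sub_eq_zero.1 (congrFun h1 j)
  exact ⟨isCompleteSimples_induced h x hx ρ hρ, isCompleteSimples_induced h x hx σ hσ, D, hD',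
    fun q D' => (isDecompositionMatrix_hat_iff (hT q) (ρ q) _ D').trans (hD' q D'),
    fun D' => isDecompositionMatrix_sigma_iff x hx T hT ρ _ D hD hind D'⟩
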